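/- Let $\mathcal X$ be a finite alphabet, $\mathcal P(\mathcal X)$ the set of probability distributions on it (with the topology of $\mathbb R^{\mathcal X}$), let $\lambda>0$, and let $\mathbf P_1,\mathbf P_2,\mathbf Q\subseteq\mathcal P(\mathcal X)$. Let $n_1(n)+n_2(n)=n$ with $n_2(n)/n_1(n)\to\lambda$. A decision rule is a set $\Omega_n\subseteq\mathcal X^{n_1}\times\mathcal X^{n_2}$; its miss-detection and false-alarm probabilities are $$p_{MD}(\Omega_n|P_1,P_2)=(P_1^{n_1}\times P_2^{n_2})(\Omega_n^c),\qquad p_{FA}(\Omega_n|Q)=(Q^{n_1}\times Q^{n_2})(\Omega_n).$$ Put $E_{MD}(\Omega|P_1,P_2)=\liminf_{n\to\infty}-\frac1n\log p_{MD}(\Omega_n|P_1,P_2)$ and $$E^*_{MD}=\sup_{\Omega\in\mathscr F}\ \inf_{P_1\in\mathbf P_1,\,P_2\in\mathbf P_2}E_{MD}(\Omega|P_1,P_2)\in[0,\infty],$$ where $\mathscr F$ is the set of sequences $\Omega=\{\Omega_n\}$ with $\lim_{n\to\infty} p_{FA}(\Omega_n|Q)=0$ for every $Q\in\mathbf Q$.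 For $0<\alpha\le(1+\lambda)^{-1}$ let $$D_{(\alpha,\lambda\alpha)}(\mathbf P_1,\mathbf P_2,\mathbf Q)=\inf_{P_1\in\mathbf P_1,P_2\in\mathbf P_2,Q\in\mathbf Q}-\log\sum_{x\in\mathcal X}P_1(x)^{\alpha}P_2(x)^{\lambda\alpha}Q(x)^{1-(1+\lambda)\alpha}$$ (with $0^0=1$, $-\log 0=+\infty$, $\inf\emptyset=+\infty$), and $E^*_{MD}(\alpha)=(1+\lambda)^{-1}\alpha^{-1}D_{(\alpha,\lambda\alpha)}(\mathbf P_1,\mathbf P_2,\mathbf Q)$. Then: 1. $E^*_{MD}\ge E^*_{MD}(\alpha)$ for every $0<\alpha\le(1+\lambda)^{-1}$. 2. $E^*_{MD}(\alpha)$ is non-increasing in $\alpha\in(0,(1+\lambda)^{-1}]$. 3. Suppose that for all $P_1\in\mathbf P_1$, $P_2\in\mathbf P_2$, every distribution in the closure of $\mathbf Q$ whose support lies in $S(P_1)\cap S(P_2)$, where $S$ denotes the support, is a limit of members of $\mathbf Q$ whose supports lie in $S(P_1)\cap S(P_2)$ (this holds, for instance, if $\mathbf Q$ is closed, or if all members of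 $\mathbf P_1$ and $\mathbf P_2$ have full support). If $E^*_{MD}<\infty$, then $\lim_{\alpha\to0^+}E^*_{MD}(\alpha)=E^*_{MD}$. -/

import Mathlib

open Filter Topology

namespace TwoSensor

/-- Probability distributions on a finite alphabet `X`, with the topology inherited from `X → ℝ`. -/
abbrev ProbDist (X : Type*) [Fintype X] : Type _ := stdSimplex ℝ X

/-- `-log p` for a real number `p ≥ 0`, with `-log 0 = +∞`. -/
noncomputable def negLog (p : ℝ) : EReal := -ENNReal.log (ENNReal.ofReal p)

/-- The probability that the product distribution `P₁^a × P₂^b` assigns to the event `A`. -/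
noncomputable def prodProb {X : Type*} [Fintype X] (P₁ P₂ : ProbDist X) {a b : ℕ}
    (A : Set ((Fin a → X) × (Fin b → X))) : ℝ :=
  ∑ z, A.indicator (fun z => (∏ i, P₁ (z.1 i)) * ∏ j, P₂ (z.2 j)) z

/-- A sequence of decision rules: for every `n`, the set of samples (`n₁ n` of them from the first
sensor and `n₂ n` of them from the second one) for which "phenomena" is declared. -/
abbrev Rules (X : Type*) (n₁ n₂ : ℕ → ℕ) : Type _ :=
  (n : ℕ) → Set ((Fin (n₁ n) → X) × (Fin (n₂ n) → X))

/-- Miss-detection probability. -/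
noncomputable def missProb {X : Type*} [Fintype X] {n₁ n₂ : ℕ → ℕ} (Ω : Rules X n₁ n₂)
    (P₁ P₂ : ProbDist X) (n : ℕ) : ℝ :=
  prodProb P₁ P₂ (Ω n)ᶜ

/-- False-alarm probability. -/
noncomputable def falseAlarmProb {X : Type*} [Fintype X] {n₁ n₂ : ℕ → ℕ} (Ω : Rules X n₁ n₂)
    (Q : ProbDist X) (n : ℕ) : ℝ :=
  prodProb Q Q (Ω n)

/-- Miss-detection exponent of a sequence of decision rules, the total sample size being `n`. -/
noncomputable def missExponent {X : Type*} [Fintype X] {n₁ n₂ : ℕ → ℕ} (Ω : Rules X n₁ n₂)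
    (P₁ P₂ : ProbDist X) : EReal :=
  liminf (fun n : ℕ => (((n : ℝ)⁻¹ : ℝ) : EReal) * negLog (missProb Ω P₁ P₂ n)) atTop

/-- The sequences of decision rules whose false-alarm probability vanishes for every noise
distribution in the family. -/
def feasible {X : Type*} [Fintype X] (n₁ n₂ : ℕ → ℕ) (Qs : Set (ProbDist X)) :
    Set (Rules X n₁ n₂) :=
  {Ω | ∀ Q ∈ Qs, Tendsto (falseAlarmProb Ω Q) atTop (𝓝 0)}

/-- The optimal worst-case miss-detection exponent. -/
noncomputable def optExponent {X : Type*} [Fintype X] (n₁ n₂ : ℕ → ℕ)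
    (Ps₁ Ps₂ Qs : Set (ProbDist X)) : EReal :=
  ⨆ Ω ∈ feasible n₁ n₂ Qs, ⨅ P₁ ∈ Ps₁, ⨅ P₂ ∈ Ps₂, missExponent Ω P₁ P₂

/-- Generalized Rényi divergence of order `a = (a₁, …, a_k)` of `k + 1` distributions; the exponent
of the last one is `1 - (a₁ + ⋯ + a_k)`. Zeroth powers are `1`, also for the base `0`. -/
noncomputable def genRenyi {X : Type*} [Fintype X] {k : ℕ} (a : Fin k → ℝ)
    (P : Fin (k + 1) → ProbDist X) : EReal :=
  negLog (∑ x, (∏ i : Fin k, P i.castSucc x ^ a i) * P (Fin.last k) x ^ (1 - ∑ i, a i))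

/-- Generalized Rényi divergence of `k + 1` families of distributions. -/
noncomputable def genRenyiFam {X : Type*} [Fintype X] {k : ℕ} (a : Fin k → ℝ)
    (Ps : Fin (k + 1) → Set (ProbDist X)) : EReal :=
  ⨅ (P : Fin (k + 1) → ProbDist X) (_ : ∀ i, P i ∈ Ps i), genRenyi a P

/-- The Rényi-type lower bound on the optimal exponent, for the sampling ratio `r`. -/
noncomputable def renyiExponent {X : Type*} [Fintype X] (r : ℝ) (Ps₁ Ps₂ Qs : Set (ProbDist X))
    (α : ℝ) : EReal :=
  (((1 + r)⁻¹ * α⁻¹ : ℝ) : EReal) * genRenyiFam ![α, r * α] ![Ps₁, Ps₂, Qs]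

/-- The distributions whose support is contained in the supports of both `P₁` and `P₂`. -/
def commonSupport {X : Type*} [Fintype X] (P₁ P₂ : ProbDist X) : Set (ProbDist X) :=
  {Q | ∀ x, Q x ≠ 0 → P₁ x ≠ 0 ∧ P₂ x ≠ 0}

end TwoSensor

/-! A real `M` is at most the Rényi exponent of order `α` exactly when every triple satisfies
`renyiSum ≤ exp (-((1 + r) * α * M))`. Hölder's inequality carries such a bound to all smaller
orders with the same `M`, which is the monotonicity.

Achievability: `typeRules` declares noise when both types are near one member of `Qs`, without
looking at `Ps₁` and `Ps₂`. A miss thus puts both types near a common `T` in the closure of `Qs`.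
Jensen's inequality turns a Rényi bound at `T` into test functions with exponential moments at most
1 under `P₁`, `P₂` and large means under `T` (`exists_tilt`). Chernoff's bound makes types near `T`
unlikely, and compactness leaves finitely many `T` (`le_missExponent_typeRules`).

Limit: at `α = 0` the Rényi sum has derivative `-(D(T‖P₁) + r D(T‖P₂))` when `T` lies in the common
support. If the exponents stayed below some `b` smaller than the optimum, compactness would give one
triple in the closures with `renyiSum ≥ exp (-((1 + r) * α * b))` along orders tending to 0
(`exists_limit_of_renyiExponent_lt`). This forces `T` into the common support and `D(T‖P₁) + r
D(T‖P₂) ≤ (1 + r) b`. The closure hypothesis moves the triple into the families, where Stein's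
converse (`missExponent_le`) contradicts the choice of `b`. -/

namespace TwoSensor

/-! ### Rényi sums: reduction to real inequalities, monotonicity, continuity. -/

section Basic

variable {X : Type*} [Fintype X]

lemma ProbDist.nonneg (P : ProbDist X) (x : X) : 0 ≤ P x := P.2.1 x

lemma ProbDist.sum_eq (P : ProbDist X) : ∑ x, P x = 1 := P.2.2

lemma ProbDist.le_one (P : ProbDist X) (x : X) : P x ≤ 1 := (mem_Icc_of_mem_stdSimplex P.2 x).2

lemma ProbDist.continuous_apply (x : X) : Continuous fun P : ProbDist X => P x :=
  (_root_.continuous_apply x).comp continuous_subtype_val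

lemma le_negLog_iff (M p : ℝ) : (M : EReal) ≤ negLog p ↔ p ≤ Real.exp (-M) := by
  unfold negLog
  rw [ENNReal.log_ofReal]
  split_ifs with h
  · simpa using h.trans (Real.exp_pos _).le
  · push Not at h
    rw [← EReal.coe_neg, EReal.coe_le_coe_iff, le_neg, Real.log_le_iff_le_exp h]

lemma negLog_le_iff (M p : ℝ) : negLog p ≤ (M : EReal) ↔ Real.exp (-M) ≤ p := by
  unfold negLog
  rw [ENNReal.log_ofReal]
  split_ifs with h
  · simpa using h.trans_lt (Real.exp_pos _)
  · push Not at h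
    rw [← EReal.coe_neg, EReal.coe_le_coe_iff, neg_le, Real.le_log_iff_exp_le h]

lemma coe_le_coe_mul_iff {c : ℝ} (hc : 0 < c) (M : ℝ) (x : EReal) :
    (M : EReal) ≤ (c : EReal) * x ↔ ((c⁻¹ * M : ℝ) : EReal) ≤ x := by
  induction x with
  | bot => rw [EReal.coe_mul_bot_of_pos hc]; simp [-EReal.coe_mul]
  | top => simp [EReal.coe_mul_top_of_pos hc]
  | coe x => rw [← EReal.coe_mul, EReal.coe_le_coe_iff, EReal.coe_le_coe_iff, inv_mul_le_iff₀ hc]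

lemma coe_mul_le_coe_iff {c : ℝ} (hc : 0 < c) (M : ℝ) (x : EReal) :
    (c : EReal) * x ≤ (M : EReal) ↔ x ≤ ((c⁻¹ * M : ℝ) : EReal) := by
  induction x with
  | bot => simp [EReal.coe_mul_bot_of_pos hc]
  | top => rw [EReal.coe_mul_top_of_pos hc]; simp [-EReal.coe_mul]
  | coe x => rw [← EReal.coe_mul, EReal.coe_le_coe_iff, EReal.coe_le_coe_iff, le_inv_mul_iff₀ hc]

/-- The sum inside the logarithm in the generalized Rényi divergence of order `(α, rα)`. -/
noncomputable def renyiSum (r α : ℝ) (P₁ P₂ Q : ProbDist X) : ℝ :=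
  ∑ x, P₁ x ^ α * P₂ x ^ (r * α) * Q x ^ (1 - (1 + r) * α)

/-- This removes extended reals and infima: later arguments treat one triple at a time. -/
lemma coe_le_renyiExponent_iff {r α : ℝ} (hr : 0 < r) (hα : 0 < α) (Ps₁ Ps₂ Qs : Set (ProbDist X))
    (M : ℝ) : (M : EReal) ≤ renyiExponent r Ps₁ Ps₂ Qs α ↔
      ∀ P₁ ∈ Ps₁, ∀ P₂ ∈ Ps₂, ∀ Q ∈ Qs, renyiSum r α P₁ P₂ Q ≤ Real.exp (-((1 + r) * α * M)) := by
  have hc : 0 < (1 + r)⁻¹ * α⁻¹ := by positivity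
  have hinv : ((1 + r)⁻¹ * α⁻¹)⁻¹ * M = (1 + r) * α * M := by rw [mul_inv, inv_inv, inv_inv]
  have hsum : ∀ P : Fin 3 → ProbDist X,
      (∑ x, (∏ i : Fin 2, P i.castSucc x ^ (![α, r * α] : Fin 2 → ℝ) i)
        * P (Fin.last 2) x ^ (1 - ∑ i, (![α, r * α] : Fin 2 → ℝ) i)) =
      renyiSum r α (P 0) (P 1) (P 2) := by
    intro P
    unfold renyiSum
    refine Finset.sum_congr rfl fun x _ => ?_
    simp only [Fin.prod_univ_two, Fin.sum_univ_two]
    have : α + r * α = (1 + r) * α := by ring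
    simp [this]
  unfold renyiExponent
  rw [coe_le_coe_mul_iff hc, hinv, genRenyiFam]
  simp only [le_iInf_iff, genRenyi]
  constructor
  · intro h P₁ h₁ P₂ h₂ Q hQ
    have := h ![P₁, P₂, Q] (by intro i; fin_cases i <;> simp [h₁, h₂, hQ])
    rw [hsum, le_negLog_iff] at this
    simpa using this
  · intro h P hP
    rw [hsum, le_negLog_iff]
    exact h _ (by simpa using hP 0) _ (by simpa using hP 1) _ (by simpa using hP 2)

/-- Hölder's inequality: after scaling `u` to total mass 1 it is weighted AM-GM in each term. -/
lemma sum_rpow_mul_rpow_le {ι : Type*} (s : Finset ι) (u w : ι → ℝ) (hu : ∀ i ∈ s, 0 ≤ u i)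
    (hw : ∀ i ∈ s, 0 ≤ w i) (hw1 : ∑ i ∈ s, w i = 1) {θ : ℝ} (h0 : 0 < θ) (h1 : θ ≤ 1) :
    ∑ i ∈ s, u i ^ θ * w i ^ (1 - θ) ≤ (∑ i ∈ s, u i) ^ θ := by
  set A := ∑ i ∈ s, u i with hA
  have hA0 : 0 ≤ A := Finset.sum_nonneg hu
  rcases hA0.eq_or_lt with h | h
  · have hz : ∀ i ∈ s, u i = 0 := (Finset.sum_eq_zero_iff_of_nonneg hu).1 h.symm
    rw [← h, Real.zero_rpow h0.ne']
    refine (Finset.sum_eq_zero fun i hi => ?_).le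
    rw [hz i hi, Real.zero_rpow h0.ne', zero_mul]
  · calc ∑ i ∈ s, u i ^ θ * w i ^ (1 - θ)
        ≤ ∑ i ∈ s, A ^ θ * (θ * (u i / A) + (1 - θ) * w i) := by
          refine Finset.sum_le_sum fun i hi => ?_
          have h2 := Real.geom_mean_le_arith_mean2_weighted h0.le (sub_nonneg.2 h1)
            (div_nonneg (hu i hi) h.le) (hw i hi) (by ring)
          have h3 : u i ^ θ = A ^ θ * (u i / A) ^ θ := by
            rw [← Real.mul_rpow h.le (div_nonneg (hu i hi) h.le), mul_div_cancel₀ _ h.ne']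
          rw [h3, mul_assoc]
          exact mul_le_mul_of_nonneg_left h2 (Real.rpow_nonneg h.le _)
      _ = A ^ θ := by
          rw [← Finset.mul_sum, Finset.sum_add_distrib, ← Finset.mul_sum, ← Finset.mul_sum, hw1,
            ← Finset.sum_div, ← hA, div_self h.ne']
          ring

lemma renyiSum_nonneg (r α : ℝ) (P₁ P₂ Q : ProbDist X) : 0 ≤ renyiSum r α P₁ P₂ Q :=
  Finset.sum_nonneg fun x _ => mul_nonneg (mul_nonneg (Real.rpow_nonneg (P₁.nonneg x) _)
    (Real.rpow_nonneg (P₂.nonneg x) _)) (Real.rpow_nonneg (Q.nonneg x) _)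

/-- With `θ = β / α`, each term of order `β` is the `θ`-th power of the term of order `α` times `Q x
^ (1 - θ)`, so Hölder applies. -/
lemma renyiSum_le_rpow {r α β : ℝ} (hr : 0 < r) (hβ : 0 < β) (hβα : β ≤ α)
    (hα : (1 + r) * α ≤ 1) (P₁ P₂ Q : ProbDist X) :
    renyiSum r β P₁ P₂ Q ≤ renyiSum r α P₁ P₂ Q ^ (β / α) := by
  rcases hβα.eq_or_lt with rfl | hlt
  · rw [div_self hβ.ne', Real.rpow_one]
  have hα0 : 0 < α := hβ.trans hlt
  have hθ : β / α < 1 := (div_lt_one hα0).2 hlt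
  refine le_trans (le_of_eq ?_) (sum_rpow_mul_rpow_le Finset.univ _ (fun x => Q x) (fun x _ => ?_)
    (fun x _ => Q.nonneg x) Q.sum_eq (div_pos hβ hα0) hθ.le)
  · refine Finset.sum_congr rfl fun x _ => ?_
    have hp1 := P₁.nonneg x
    have hp2 := P₂.nonneg x
    have hq := Q.nonneg x
    rw [Real.mul_rpow (by positivity) (by positivity), Real.mul_rpow (by positivity) (by positivity),
      ← Real.rpow_mul hp1, ← Real.rpow_mul hp2, ← Real.rpow_mul hq, mul_assoc, mul_assoc, mul_assoc]
    have e1 : α * (β / α) = β := mul_div_cancel₀ _ hα0.ne'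
    have e2 : r * α * (β / α) = r * β := by rw [mul_assoc, e1]
    rw [e1, e2]
    congr 2
    have e3 : (1 - (1 + r) * α) * (β / α) + (1 - β / α) = 1 - (1 + r) * β := by
      rw [sub_mul, mul_assoc, e1]; ring
    -- Powers of 0 do not merge, but `β < α` makes the exponents `1 - (1 + r) * β` and `1 - β / α`
    -- positive, so both sides vanish.
    rcases hq.eq_or_lt with h | h
    · have : 0 < 1 - (1 + r) * β := by nlinarith
      rw [← h, Real.zero_rpow this.ne', Real.zero_rpow (sub_pos.2 hθ).ne', mul_zero]
    · rw [← Real.rpow_add h, e3]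
  · have hp1 := P₁.nonneg x
    have hp2 := P₂.nonneg x
    have hq := Q.nonneg x
    positivity

lemma renyiSum_le_exp_of_le {r α β : ℝ} (hr : 0 < r) (hβ : 0 < β) (hβα : β ≤ α)
    (hα : (1 + r) * α ≤ 1) {P₁ P₂ Q : ProbDist X} {M : ℝ}
    (h : renyiSum r α P₁ P₂ Q ≤ Real.exp (-((1 + r) * α * M))) :
    renyiSum r β P₁ P₂ Q ≤ Real.exp (-((1 + r) * β * M)) := by
  have hα0 : 0 < α := hβ.trans_le hβα
  refine (renyiSum_le_rpow hr hβ hβα hα P₁ P₂ Q).trans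
    ((Real.rpow_le_rpow (renyiSum_nonneg _ _ _ _ _) h (div_pos hβ hα0).le).trans_eq ?_)
  rw [← Real.exp_mul]
  congr 1
  field_simp

lemma mul_le_one_of_le_inv {r α : ℝ} (hr : 0 < r) (h : α ≤ (1 + r)⁻¹) : (1 + r) * α ≤ 1 := by
  rwa [← le_inv_mul_iff₀ (by positivity), mul_one]

lemma renyiExponent_antitoneOn {r : ℝ} (hr : 0 < r) (Ps₁ Ps₂ Qs : Set (ProbDist X)) :
    AntitoneOn (renyiExponent r Ps₁ Ps₂ Qs) (Set.Ioc 0 (1 + r)⁻¹) := by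
  intro β hβ α hα h
  refine EReal.ge_of_forall_gt_iff_ge.1 fun M hM => ?_
  have hM' := (coe_le_renyiExponent_iff hr hα.1 _ _ _ _).1 hM.le
  exact (coe_le_renyiExponent_iff hr hβ.1 _ _ _ _).2 fun P₁ h₁ P₂ h₂ Q hQ =>
    renyiSum_le_exp_of_le hr hβ.1 h (mul_le_one_of_le_inv hr hα.2) (hM' P₁ h₁ P₂ h₂ Q hQ)

lemma continuous_renyiSum {r α : ℝ} (hr : 0 < r) (hα : 0 < α) (hα1 : (1 + r) * α < 1) :
    Continuous fun p : ProbDist X × ProbDist X × ProbDist X => renyiSum r α p.1 p.2.1 p.2.2 := by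
  unfold renyiSum
  refine continuous_finsetSum _ fun x _ => ?_
  have hc := ProbDist.continuous_apply (X := X) x
  refine ((hc.comp continuous_fst).rpow_const fun _ => Or.inr hα.le).mul
    ((hc.comp (continuous_fst.comp continuous_snd)).rpow_const fun _ => Or.inr (by positivity))
    |>.mul ((hc.comp (continuous_snd.comp continuous_snd)).rpow_const fun _ => Or.inr (by linarith))

lemma renyiSum_le_of_mem_closure {r α : ℝ} (hr : 0 < r) (hα : 0 < α) (hα1 : (1 + r) * α < 1)
    {P₁ P₂ : ProbDist X} {Qs : Set (ProbDist X)} {c : ℝ}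
    (h : ∀ Q ∈ Qs, renyiSum r α P₁ P₂ Q ≤ c) {Q : ProbDist X} (hQ : Q ∈ closure Qs) :
    renyiSum r α P₁ P₂ Q ≤ c := by
  have hc : Continuous fun Q => renyiSum r α P₁ P₂ Q :=
    (continuous_renyiSum hr hα hα1).comp
      (continuous_const.prodMk (continuous_const.prodMk continuous_id))
  exact closure_minimal (t := {Q | renyiSum r α P₁ P₂ Q ≤ c}) h
    (isClosed_le hc continuous_const) hQ

end Basic

/-! ### Product measures and exponential moment bounds. -/

section Concentration

variable {X : Type*} [Fintype X]

/-- The probability of a single pair of samples under `P₁^a × P₂^b`. -/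
noncomputable def prodWeight (P₁ P₂ : ProbDist X) {a b : ℕ} (z : (Fin a → X) × (Fin b → X)) : ℝ :=
  (∏ i, P₁ (z.1 i)) * ∏ j, P₂ (z.2 j)

variable {a b : ℕ}

lemma prodWeight_nonneg (P₁ P₂ : ProbDist X) (z : (Fin a → X) × (Fin b → X)) :
    0 ≤ prodWeight P₁ P₂ z :=
  mul_nonneg (Finset.prod_nonneg fun _ _ => P₁.nonneg _) (Finset.prod_nonneg fun _ _ => P₂.nonneg _)

lemma prodProb_eq (P₁ P₂ : ProbDist X) (A : Set ((Fin a → X) × (Fin b → X))) :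
    prodProb P₁ P₂ A = ∑ z, A.indicator (prodWeight P₁ P₂) z := rfl

lemma prodProb_nonneg (P₁ P₂ : ProbDist X) (A : Set ((Fin a → X) × (Fin b → X))) :
    0 ≤ prodProb P₁ P₂ A :=
  Finset.sum_nonneg fun z _ => Set.indicator_nonneg (fun z _ => prodWeight_nonneg P₁ P₂ z) z

lemma prodProb_mono (P₁ P₂ : ProbDist X) {A B : Set ((Fin a → X) × (Fin b → X))} (h : A ⊆ B) :
    prodProb P₁ P₂ A ≤ prodProb P₁ P₂ B :=
  Finset.sum_le_sum fun z _ =>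
    Set.indicator_le_indicator_of_subset h (fun z => prodWeight_nonneg P₁ P₂ z) z

lemma prodProb_biUnion_le (P₁ P₂ : ProbDist X) {ι : Type*} (s : Finset ι)
    (A : ι → Set ((Fin a → X) × (Fin b → X))) :
    prodProb P₁ P₂ (⋃ i ∈ s, A i) ≤ ∑ i ∈ s, prodProb P₁ P₂ (A i) := by
  simp only [prodProb_eq]
  rw [Finset.sum_comm]
  refine Finset.sum_le_sum fun z _ => ?_
  have hnn : ∀ i ∈ s, 0 ≤ (A i).indicator (prodWeight P₁ P₂) z := fun i _ =>
    Set.indicator_nonneg (fun z _ => prodWeight_nonneg P₁ P₂ z) z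
  by_cases hz : z ∈ ⋃ i ∈ s, A i
  · obtain ⟨i, hi, hzi⟩ := Set.mem_iUnion₂.1 hz
    rw [Set.indicator_of_mem hz]
    refine le_trans ?_ (Finset.single_le_sum hnn hi)
    rw [Set.indicator_of_mem hzi]
  · rw [Set.indicator_of_notMem hz]
    exact Finset.sum_nonneg hnn

lemma prodProb_union_le (P₁ P₂ : ProbDist X) (A B : Set ((Fin a → X) × (Fin b → X))) :
    prodProb P₁ P₂ (A ∪ B) ≤ prodProb P₁ P₂ A + prodProb P₁ P₂ B := by
  have h := prodProb_biUnion_le P₁ P₂ Finset.univ fun c : Bool => cond c A B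
  simpa [Set.union_eq_iUnion] using h

/-- Independence: the exponential moment of a sum factorizes over the samples. -/
lemma sum_mul_exp_eq (P₁ P₂ : ProbDist X) (f₁ f₂ : X → ℝ) :
    ∑ z : (Fin a → X) × (Fin b → X),
      prodWeight P₁ P₂ z * Real.exp (∑ i, f₁ (z.1 i) + ∑ j, f₂ (z.2 j)) =
    (∑ x, P₁ x * Real.exp (f₁ x)) ^ a * (∑ x, P₂ x * Real.exp (f₂ x)) ^ b := by
  rw [Fintype.sum_pow, Fintype.sum_pow, Fintype.sum_prod_type, Finset.sum_mul_sum]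
  refine Finset.sum_congr rfl fun x _ => Finset.sum_congr rfl fun y _ => ?_
  rw [prodWeight, Real.exp_add, Real.exp_sum, Real.exp_sum, Finset.prod_mul_distrib,
    Finset.prod_mul_distrib]
  ring

lemma prodProb_univ (P₁ P₂ : ProbDist X) :
    prodProb P₁ P₂ (Set.univ : Set ((Fin a → X) × (Fin b → X))) = 1 := by
  have h := sum_mul_exp_eq (a := a) (b := b) P₁ P₂ 0 0
  simpa [P₁.sum_eq, P₂.sum_eq, prodProb_eq] using h

lemma prodProb_compl (P₁ P₂ : ProbDist X) (A : Set ((Fin a → X) × (Fin b → X))) :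
    prodProb P₁ P₂ Aᶜ = 1 - prodProb P₁ P₂ A := by
  rw [eq_sub_iff_add_eq, ← prodProb_univ (a := a) (b := b) P₁ P₂, prodProb_eq, prodProb_eq,
    prodProb_eq, ← Finset.sum_add_distrib]
  refine Finset.sum_congr rfl fun z _ => ?_
  rw [Set.indicator_univ, add_comm]
  exact congrFun (Set.indicator_self_add_compl A (prodWeight P₁ P₂)) z

/-- Chernoff's bound for sums of functions of the single samples. -/
lemma prodProb_le_of_sum_nonneg (P₁ P₂ : ProbDist X) {A : Set ((Fin a → X) × (Fin b → X))}
    (f₁ f₂ : X → ℝ) (h : ∀ z ∈ A, 0 ≤ ∑ i, f₁ (z.1 i) + ∑ j, f₂ (z.2 j)) :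
    prodProb P₁ P₂ A ≤
      (∑ x, P₁ x * Real.exp (f₁ x)) ^ a * (∑ x, P₂ x * Real.exp (f₂ x)) ^ b := by
  rw [← sum_mul_exp_eq, prodProb_eq]
  refine Finset.sum_le_sum fun z _ => ?_
  by_cases hz : z ∈ A
  · rw [Set.indicator_of_mem hz]
    exact le_mul_of_one_le_right (prodWeight_nonneg _ _ _) (Real.one_le_exp (h z hz))
  · rw [Set.indicator_of_notMem hz]
    exact mul_nonneg (prodWeight_nonneg _ _ _) (Real.exp_pos _).le

lemma sum_mul_exp_le (Q : ProbDist X) {h : X → ℝ} (h0 : ∑ x, Q x * h x = 0) {s B : ℝ}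
    (hs : 0 ≤ s) (hB : ∀ x, |h x| ≤ B) (hsB : s * B ≤ 1) :
    ∑ x, Q x * Real.exp (s * h x) ≤ Real.exp (s ^ 2 * B ^ 2) := by
  calc ∑ x, Q x * Real.exp (s * h x)
      ≤ ∑ x, Q x * (1 + s * h x + s ^ 2 * B ^ 2) := by
        refine Finset.sum_le_sum fun x _ => mul_le_mul_of_nonneg_left ?_ (Q.nonneg x)
        have h1 : |s * h x| ≤ s * B := by
          rw [abs_mul, abs_of_nonneg hs]
          exact mul_le_mul_of_nonneg_left (hB x) hs
        -- For `|u| ≤ 1`, `exp u ≤ 1 + u + u ^ 2`; the linear term averages to 0.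
        have h2 := (abs_le.1 (Real.abs_exp_sub_one_sub_id_le (h1.trans hsB))).2
        have h3 : (s * h x) ^ 2 ≤ (s * B) ^ 2 := sq_le_sq' (abs_le.1 h1).1 (abs_le.1 h1).2
        rw [mul_pow s B] at h3
        linarith
    _ = s ^ 2 * B ^ 2 + 1 := by
        have : ∀ x, Q x * (1 + s * h x + s ^ 2 * B ^ 2) =
            (1 + s ^ 2 * B ^ 2) * Q x + s * (Q x * h x) := fun x => by ring
        simp only [this, Finset.sum_add_distrib, ← Finset.mul_sum, h0, Q.sum_eq]
        ring
    _ ≤ _ := Real.add_one_le_exp _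

/-- A deviation inequality for sums of centred bounded functions of independent samples. -/
lemma prodProb_deviation_le (Q₁ Q₂ : ProbDist X) {h₁ h₂ : X → ℝ} (h10 : ∑ x, Q₁ x * h₁ x = 0)
    (h20 : ∑ x, Q₂ x * h₂ x = 0) {s B₁ B₂ : ℝ} (t₁ t₂ : ℝ) (hs : 0 ≤ s) (hB₁ : ∀ x, |h₁ x| ≤ B₁)
    (hB₂ : ∀ x, |h₂ x| ≤ B₂) (hsB₁ : s * B₁ ≤ 1) (hsB₂ : s * B₂ ≤ 1) :
    prodProb Q₁ Q₂ {z : (Fin a → X) × (Fin b → X) |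
        a * t₁ + b * t₂ ≤ ∑ i, h₁ (z.1 i) + ∑ j, h₂ (z.2 j)} ≤
      Real.exp (a * (s ^ 2 * B₁ ^ 2 - s * t₁) + b * (s ^ 2 * B₂ ^ 2 - s * t₂)) := by
  have key : ∀ (Q : ProbDist X) (h : X → ℝ) (B t : ℝ), ∑ x, Q x * h x = 0 → (∀ x, |h x| ≤ B) →
      s * B ≤ 1 →
      ∑ x, Q x * Real.exp (s * (h x - t)) ≤ Real.exp (s ^ 2 * B ^ 2 - s * t) := by
    intro Q h B t h0 hB hsB
    have : ∀ x, Q x * Real.exp (s * (h x - t)) = Q x * Real.exp (s * h x) * Real.exp (-(s * t)) := by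
      intro x
      rw [mul_assoc, ← Real.exp_add]
      congr 2
      ring
    simp only [this]
    rw [← Finset.sum_mul, sub_eq_add_neg, Real.exp_add]
    exact mul_le_mul_of_nonneg_right (sum_mul_exp_le Q h0 hs hB hsB) (Real.exp_pos _).le
  refine (prodProb_le_of_sum_nonneg Q₁ Q₂ (fun x => s * (h₁ x - t₁)) (fun x => s * (h₂ x - t₂))
    ?_).trans ?_
  · intro z hz
    simp only [← Finset.mul_sum, Finset.sum_sub_distrib, Finset.sum_const, Finset.card_univ,
      Fintype.card_fin, nsmul_eq_mul]
    rw [← mul_add]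
    refine mul_nonneg hs ?_
    have : (a : ℝ) * t₁ + b * t₂ ≤ ∑ i, h₁ (z.1 i) + ∑ j, h₂ (z.2 j) := hz
    linarith
  · rw [Real.exp_add, Real.exp_nat_mul, Real.exp_nat_mul]
    have hn : ∀ (Q : ProbDist X) (h : X → ℝ) (t : ℝ), 0 ≤ ∑ x, Q x * Real.exp (s * (h x - t)) :=
      fun Q h t => Finset.sum_nonneg fun x _ => mul_nonneg (Q.nonneg x) (Real.exp_pos _).le
    exact mul_le_mul (pow_le_pow_left₀ (hn _ _ _) (key Q₁ h₁ B₁ t₁ h10 hB₁ hsB₁) _)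
      (pow_le_pow_left₀ (hn _ _ _) (key Q₂ h₂ B₂ t₂ h20 hB₂ hsB₂) _) (pow_nonneg (hn _ _ _) _)
      (pow_nonneg (Real.exp_pos _).le _)

end Concentration

/-! ### Asymptotics of the two sample sizes. -/

section SampleSizes

variable {r : ℝ} {n₁ n₂ : ℕ → ℕ}

lemma tendsto_first_fraction (hr : 0 < r) (hsum : ∀ n, n₁ n + n₂ n = n)
    (hratio : Tendsto (fun n => (n₂ n : ℝ) / (n₁ n : ℝ)) atTop (𝓝 r)) :
    Tendsto (fun n : ℕ => (n₁ n : ℝ) / n) atTop (𝓝 (1 + r)⁻¹) := by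
  have h1 : Tendsto (fun n => (1 + (n₂ n : ℝ) / (n₁ n : ℝ))⁻¹) atTop (𝓝 (1 + r)⁻¹) :=
    (hratio.const_add 1).inv₀ (by positivity)
  refine h1.congr' ?_
  -- Division by zero gives 0, so a positive ratio forces `n₁ n ≠ 0`.
  filter_upwards [hratio.eventually (lt_mem_nhds hr)] with n hn
  have hn1 : (n₁ n : ℝ) ≠ 0 := by
    intro h
    rw [h, div_zero] at hn
    exact lt_irrefl _ hn
  have : (n : ℝ) = n₁ n + n₂ n := by exact_mod_cast (hsum n).symm
  rw [this, one_add_div hn1, inv_div]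

lemma tendsto_second_fraction (hr : 0 < r) (hsum : ∀ n, n₁ n + n₂ n = n)
    (hratio : Tendsto (fun n => (n₂ n : ℝ) / (n₁ n : ℝ)) atTop (𝓝 r)) :
    Tendsto (fun n : ℕ => (n₂ n : ℝ) / n) atTop (𝓝 (r * (1 + r)⁻¹)) := by
  have h1 := (tendsto_first_fraction hr hsum hratio).const_sub 1
  have h2 : 1 - (1 + r)⁻¹ = r * (1 + r)⁻¹ := by field_simp; ring
  rw [h2] at h1
  refine h1.congr' ?_
  filter_upwards [eventually_gt_atTop 0] with n hn
  have hn0 : (n : ℝ) ≠ 0 := by exact_mod_cast hn.ne'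
  have : (n : ℝ) = n₁ n + n₂ n := by exact_mod_cast (hsum n).symm
  rw [eq_div_iff hn0, sub_mul, div_mul_cancel₀ _ hn0]
  linarith

lemma tendsto_atTop_of_fraction {m : ℕ → ℕ} {c : ℝ} (hc : 0 < c)
    (h : Tendsto (fun n : ℕ => (m n : ℝ) / n) atTop (𝓝 c)) :
    Tendsto (fun n => (m n : ℝ)) atTop atTop := by
  refine (h.pos_mul_atTop hc tendsto_natCast_atTop_atTop).congr' ?_
  filter_upwards [eventually_gt_atTop 0] with n hn
  exact div_mul_cancel₀ _ (by exact_mod_cast hn.ne')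

/-- Per-sample rates `d₁`, `d₂` amount to `(d₁ + r * d₂) / (1 + r)` per unit of `n`; a strict gap
therefore grows linearly and absorbs any constant factor. -/
lemma tendsto_sub_mul_atTop (hr : 0 < r) (hsum : ∀ n, n₁ n + n₂ n = n)
    (hratio : Tendsto (fun n => (n₂ n : ℝ) / (n₁ n : ℝ)) atTop (𝓝 r)) {d₁ d₂ c : ℝ}
    (h : (1 + r) * c < d₁ + r * d₂) :
    Tendsto (fun n : ℕ => n₁ n * d₁ + n₂ n * d₂ - n * c) atTop atTop := by
  have h1 := (((tendsto_first_fraction hr hsum hratio).mul_const d₁).add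
    ((tendsto_second_fraction hr hsum hratio).mul_const d₂)).sub_const c
  have hpos : 0 < (1 + r)⁻¹ * d₁ + r * (1 + r)⁻¹ * d₂ - c := by
    have : (1 + r)⁻¹ * d₁ + r * (1 + r)⁻¹ * d₂ - c = (1 + r)⁻¹ * (d₁ + r * d₂ - (1 + r) * c) := by
      field_simp
    rw [this]
    exact mul_pos (by positivity) (by linarith)
  refine (h1.pos_mul_atTop hpos tendsto_natCast_atTop_atTop).congr' ?_
  filter_upwards [eventually_gt_atTop 0] with n hn
  have hn0 : (n : ℝ) ≠ 0 := by exact_mod_cast hn.ne'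
  field_simp

end SampleSizes

/-! ### Stein's converse by change of measure. -/

section Converse

variable {X : Type*} [Fintype X]

/-- The function whose expectation under `Q` is the relative entropy of `Q` with respect to `P`. -/
noncomputable def logRatio (Q P : ProbDist X) (x : X) : ℝ := Real.log (Q x) - Real.log (P x)

/-- Equality holds on the support of `Q`; elsewhere the left side is 0, so the value `Real.log 0 =
0` does no harm. -/
lemma mul_exp_neg_logRatio_le {Q P : ProbDist X} (h : ∀ x, Q x ≠ 0 → P x ≠ 0) (x : X) :
    Q x * Real.exp (-logRatio Q P x) ≤ P x := by
  rcases (Q.nonneg x).eq_or_lt with h0 | h0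
  · rw [← h0, zero_mul]
    exact P.nonneg x
  · have hP : 0 < P x := lt_of_le_of_ne (P.nonneg x) (h x h0.ne').symm
    rw [logRatio, neg_sub, Real.exp_sub, Real.exp_log h0, Real.exp_log hP, mul_div_cancel₀ _ h0.ne']

lemma prodWeight_mul_exp_le {a b : ℕ} {Q P₁ P₂ : ProbDist X} (hQ : Q ∈ commonSupport P₁ P₂)
    (z : (Fin a → X) × (Fin b → X)) :
    prodWeight Q Q z *
        Real.exp (-(∑ i, logRatio Q P₁ (z.1 i) + ∑ j, logRatio Q P₂ (z.2 j))) ≤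
      prodWeight P₁ P₂ z := by
  rw [neg_add, Real.exp_add, ← Finset.sum_neg_distrib, ← Finset.sum_neg_distrib, Real.exp_sum,
    Real.exp_sum, prodWeight, mul_mul_mul_comm, ← Finset.prod_mul_distrib,
    ← Finset.prod_mul_distrib]
  have hnn : ∀ P x, 0 ≤ Q x * Real.exp (-logRatio Q P x) := fun P x =>
    mul_nonneg (Q.nonneg x) (Real.exp_pos _).le
  exact mul_le_mul
    (Finset.prod_le_prod (fun _ _ => hnn _ _)
      fun i _ => mul_exp_neg_logRatio_le (fun x hx => (hQ x hx).1) _)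
    (Finset.prod_le_prod (fun _ _ => hnn _ _)
      fun i _ => mul_exp_neg_logRatio_le (fun x hx => (hQ x hx).2) _)
    (Finset.prod_nonneg fun _ _ => hnn _ _) (Finset.prod_nonneg fun _ _ => P₁.nonneg _)

/-- Change of measure on the event where the log-likelihood ratio is at most `L`. -/
lemma exp_neg_mul_sub_le_prodProb {a b : ℕ} {Q P₁ P₂ : ProbDist X} (hQ : Q ∈ commonSupport P₁ P₂)
    (A : Set ((Fin a → X) × (Fin b → X))) (L : ℝ) :
    Real.exp (-L) * (prodProb Q Q A - prodProb Q Q {z : (Fin a → X) × (Fin b → X) |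
        L ≤ ∑ i, logRatio Q P₁ (z.1 i) + ∑ j, logRatio Q P₂ (z.2 j)}) ≤ prodProb P₁ P₂ A := by
  rw [prodProb_eq, prodProb_eq, prodProb_eq, ← Finset.sum_sub_distrib, Finset.mul_sum]
  refine Finset.sum_le_sum fun z _ => ?_
  set S := {z : (Fin a → X) × (Fin b → X) |
        L ≤ ∑ i, logRatio Q P₁ (z.1 i) + ∑ j, logRatio Q P₂ (z.2 j)}
  have hq := prodWeight_nonneg Q Q z
  have hp := prodWeight_nonneg P₁ P₂ z
  have he := (Real.exp_pos (-L)).le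
  by_cases hA : z ∈ A
  · rw [Set.indicator_of_mem hA, Set.indicator_of_mem hA]
    by_cases hS : z ∈ S
    · rw [Set.indicator_of_mem hS, sub_self, mul_zero]
      exact hp
    · rw [Set.indicator_of_notMem hS, sub_zero]
      refine le_trans ?_ (prodWeight_mul_exp_le hQ z)
      rw [mul_comm]
      exact mul_le_mul_of_nonneg_left (Real.exp_le_exp.2 (neg_le_neg (not_le.1 hS).le)) hq
  · rw [Set.indicator_of_notMem hA, Set.indicator_of_notMem hA, zero_sub, mul_neg, neg_nonpos]
    exact mul_nonneg he (Set.indicator_nonneg (fun z _ => prodWeight_nonneg Q Q z) z)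

/-- Stein's converse: a vanishing false-alarm probability bounds the miss-detection exponent. -/
lemma missExponent_le {r : ℝ} {n₁ n₂ : ℕ → ℕ} (hr : 0 < r) (hsum : ∀ n, n₁ n + n₂ n = n)
    (hratio : Tendsto (fun n => (n₂ n : ℝ) / (n₁ n : ℝ)) atTop (𝓝 r)) {Q P₁ P₂ : ProbDist X}
    (hQ : Q ∈ commonSupport P₁ P₂) {Ω : Rules X n₁ n₂}
    (hΩ : Tendsto (falseAlarmProb Ω Q) atTop (𝓝 0)) {c : ℝ}
    (hc : ∑ x, Q x * logRatio Q P₁ x + r * ∑ x, Q x * logRatio Q P₂ x < (1 + r) * c) :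
    missExponent Ω P₁ P₂ ≤ c := by
  set D₁ := ∑ x, Q x * logRatio Q P₁ x with hD₁
  set D₂ := ∑ x, Q x * logRatio Q P₂ x with hD₂
  obtain ⟨ε, hε, hεc⟩ : ∃ ε > 0, (D₁ + ε) + r * (D₂ + ε) < (1 + r) * c := by
    -- Adding `ε` to both divergences costs `(1 + r) * ε`, half of the gap.
    refine ⟨((1 + r) * c - (D₁ + r * D₂)) / (2 * (1 + r)), by
      apply div_pos <;> nlinarith, ?_⟩
    have : (D₁ + ((1 + r) * c - (D₁ + r * D₂)) / (2 * (1 + r))) +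
        r * (D₂ + ((1 + r) * c - (D₁ + r * D₂)) / (2 * (1 + r))) =
        D₁ + r * D₂ + ((1 + r) * c - (D₁ + r * D₂)) / 2 := by
      field_simp; ring
    rw [this]
    linarith
  obtain ⟨B, hB, hB₁, hB₂⟩ : ∃ B > 0, (∀ x, |logRatio Q P₁ x - D₁| ≤ B) ∧
      ∀ x, |logRatio Q P₂ x - D₂| ≤ B := by
    obtain ⟨B₁, hB₁⟩ := (Set.finite_range fun x => |logRatio Q P₁ x - D₁|).bddAbove
    obtain ⟨B₂, hB₂⟩ := (Set.finite_range fun x => |logRatio Q P₂ x - D₂|).bddAbove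
    exact ⟨max 1 (max B₁ B₂), lt_max_of_lt_left one_pos,
      fun x => (hB₁ ⟨x, rfl⟩).trans ((le_max_left _ _).trans (le_max_right _ _)),
      fun x => (hB₂ ⟨x, rfl⟩).trans ((le_max_right _ _).trans (le_max_right _ _))⟩
  obtain ⟨s, hs, hsB, hsε⟩ : ∃ s > 0, s * B ≤ 1 ∧ s ^ 2 * B ^ 2 - s * ε < 0 := by
    -- The first entry gives `s * B ≤ 1`, the second `s ^ 2 * B ^ 2 ≤ s * ε / 2`.
    refine ⟨min B⁻¹ (ε / (2 * B ^ 2)), lt_min (by positivity) (by positivity), ?_, ?_⟩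
    · exact (mul_le_mul_of_nonneg_right (min_le_left _ _) hB.le).trans_eq (inv_mul_cancel₀ hB.ne')
    · set s := min B⁻¹ (ε / (2 * B ^ 2))
      have hs : 0 < s := lt_min (by positivity) (by positivity)
      have h1 : s * (2 * B ^ 2) ≤ ε := (le_div_iff₀ (by positivity)).1 (min_le_right _ _)
      nlinarith [mul_le_mul_of_nonneg_left h1 hs.le, mul_pos hs hε]
  have hcentre : ∀ P : ProbDist X, ∑ x, Q x * (logRatio Q P x - ∑ x, Q x * logRatio Q P x) = 0 := by
    intro P
    simp only [mul_sub, Finset.sum_sub_distrib, ← Finset.sum_mul, Q.sum_eq, one_mul, sub_self]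
  have hbad : Tendsto (fun n : ℕ => Real.exp ((n : ℝ) * (s ^ 2 * B ^ 2 - s * ε))) atTop (𝓝 0) :=
    Real.tendsto_exp_atBot.comp (tendsto_natCast_atTop_atTop.atTop_mul_const_of_neg hsε)
  have hgrow : Tendsto (fun n : ℕ => n₁ n * (-(D₁ + ε)) + n₂ n * (-(D₂ + ε)) - n * (-c)) atTop
      atTop := tendsto_sub_mul_atTop hr hsum hratio (by linarith)
  refine liminf_le_of_frequently_le' (Eventually.frequently ?_)
  filter_upwards [hbad.eventually (gt_mem_nhds (by norm_num : (0 : ℝ) < 1 / 4)),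
    hΩ.eventually (gt_mem_nhds (by norm_num : (0 : ℝ) < 1 / 4)),
    hgrow.eventually_ge_atTop (Real.log 2), eventually_gt_atTop 0] with n hn1 hn2 hn3 hn4
  have hn0 : (0 : ℝ) < n := by exact_mod_cast hn4
  rw [coe_mul_le_coe_iff (inv_pos.2 hn0), inv_inv, negLog_le_iff]
  set L : ℝ := n₁ n * (D₁ + ε) + n₂ n * (D₂ + ε) with hL
  refine le_trans ?_ (exp_neg_mul_sub_le_prodProb hQ (Ω n)ᶜ L)
  have hdev := prodProb_deviation_le (a := n₁ n) (b := n₂ n) Q Q (hcentre P₁) (hcentre P₂) ε ε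
    hs.le hB₁ hB₂ hsB hsB
  have hset : {z : (Fin (n₁ n) → X) × (Fin (n₂ n) → X) |
      L ≤ ∑ i, logRatio Q P₁ (z.1 i) + ∑ j, logRatio Q P₂ (z.2 j)} =
      {z | (n₁ n : ℝ) * ε + n₂ n * ε ≤
        ∑ i, (logRatio Q P₁ (z.1 i) - ∑ x, Q x * logRatio Q P₁ x) +
          ∑ j, (logRatio Q P₂ (z.2 j) - ∑ x, Q x * logRatio Q P₂ x)} := by
    ext z
    simp only [Set.mem_ofPred_eq, Finset.sum_sub_distrib, Finset.sum_const, Finset.card_univ,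
      Fintype.card_fin, nsmul_eq_mul, hL, ← hD₁, ← hD₂]
    constructor <;> intro h <;> linarith
  rw [hset, prodProb_compl]
  have hnn : (n₁ n : ℝ) + n₂ n = n := by exact_mod_cast hsum n
  rw [← add_mul _ _ (s ^ 2 * B ^ 2 - s * ε), hnn] at hdev
  have hfa : prodProb Q Q (Ω n) < 1 / 4 := hn2
  -- Under `Q` the miss region has mass above 3/4 and the event of log-likelihood ratio at least `L`
  -- below 1/4. The remaining factor 1/2 is paid for by the `log 2` in `hn3`.
  have hhalf : Real.exp (-(n * c)) ≤ Real.exp (-L) * (1 / 2) := by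
    have : (1 / 2 : ℝ) = Real.exp (-Real.log 2) := by
      rw [Real.exp_neg, Real.exp_log two_pos, one_div]
    rw [this, ← Real.exp_add, Real.exp_le_exp, hL]
    linarith
  exact hhalf.trans (mul_le_mul_of_nonneg_left (by linarith) (Real.exp_pos _).le)

end Converse

/-! ### The type-based rule and its exponent. -/

section Achievability

variable {X : Type*} [Fintype X]

open Classical in
/-- The empirical distribution (type) of a sample. -/
noncomputable def empirical {k : ℕ} (x : Fin k → X) (a : X) : ℝ :=
  (∑ i, if x i = a then 1 else 0) / k

lemma sum_empirical_mul {k : ℕ} (hk : 0 < k) (x : Fin k → X) (f : X → ℝ) :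
    k * ∑ a, empirical x a * f a = ∑ i, f (x i) := by
  classical
  have hk0 : (k : ℝ) ≠ 0 := by exact_mod_cast hk.ne'
  have : ∀ a, (k : ℝ) * (empirical x a * f a) = ∑ i, if x i = a then f a else 0 := by
    intro a
    rw [← mul_assoc, empirical, mul_div_cancel₀ _ hk0, Finset.sum_mul]
    simp
  rw [Finset.mul_sum, Finset.sum_congr rfl fun a _ => this a, Finset.sum_comm]
  simp

/-- A radius vanishing slowly enough for the law of large numbers. -/
noncomputable def slowRadius (k : ℕ) : ℝ := (√(√k))⁻¹

lemma slowRadius_nonneg (k : ℕ) : 0 ≤ slowRadius k := inv_nonneg.2 (Real.sqrt_nonneg _)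

lemma slowRadius_le_one {k : ℕ} (hk : 0 < k) : slowRadius k ≤ 1 :=
  inv_le_one_of_one_le₀ (Real.one_le_sqrt.2 (Real.one_le_sqrt.2 (by exact_mod_cast hk)))

/-- The Chernoff exponent at this radius is a multiple of `√k`, which diverges although the radius
tends to 0. -/
lemma mul_slowRadius_sq (k : ℕ) : k * slowRadius k ^ 2 = √k := by
  rw [slowRadius, inv_pow, Real.sq_sqrt (Real.sqrt_nonneg _), ← div_eq_mul_inv, Real.div_sqrt]

lemma tendsto_slowRadius {m : ℕ → ℕ} (hm : Tendsto (fun n => (m n : ℝ)) atTop atTop) :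
    Tendsto (fun n => slowRadius (m n)) atTop (𝓝 0) :=
  tendsto_inv_atTop_zero.comp
    (Real.tendsto_sqrt_atTop.comp (Real.tendsto_sqrt_atTop.comp hm))

/-- Noise is declared when both empirical distributions are close to one and the same noise
distribution of the family. -/
noncomputable def typeRules (n₁ n₂ : ℕ → ℕ) (Qs : Set (ProbDist X)) : Rules X n₁ n₂ := fun n =>
  {z | ∃ Q ∈ Qs, dist (empirical z.1) Q.1 ≤ slowRadius (n₁ n) ∧
    dist (empirical z.2) Q.1 ≤ slowRadius (n₂ n)}ᶜ

-- The deviation bound is applied to the centred indicator of `x` with both signs, the other sensor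
-- receiving the zero function.
open Classical in
lemma prodProb_abs_empirical_sub_le (Q : ProbDist X) {a b : ℕ} (x : X) (ha : 0 < a) (hb : 0 < b) :
    prodProb Q Q {z : (Fin a → X) × (Fin b → X) | slowRadius a < |empirical z.1 x - Q x|} ≤
        2 * Real.exp (-(√a / 4)) ∧
      prodProb Q Q {z : (Fin a → X) × (Fin b → X) | slowRadius b < |empirical z.2 x - Q x|} ≤
        2 * Real.exp (-(√b / 4)) := by
  have hcentre : ∀ σ : ℝ, ∑ y, Q y * (σ * ((if y = x then 1 else 0) - Q x)) = 0 := by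
    intro σ
    have : ∀ y, Q y * (σ * ((if y = x then 1 else 0) - Q x)) =
        σ * (Q y * (if y = x then 1 else 0)) - σ * Q x * Q y := fun y => by ring
    simp only [this, Finset.sum_sub_distrib, ← Finset.mul_sum, Q.sum_eq]
    simp
  have hbound : ∀ σ : ℝ, |σ| = 1 → ∀ y, |σ * ((if y = x then 1 else 0) - Q x)| ≤ 1 := by
    intro σ hσ y
    have h0 := Q.nonneg x
    have h1 := Q.le_one x
    rw [abs_mul, hσ, one_mul, abs_le]
    split_ifs <;> constructor <;> linarith
  have hemp : ∀ {k : ℕ}, 0 < k → ∀ (σ : ℝ) (y : Fin k → X),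
      ∑ i, σ * ((if y i = x then 1 else 0) - Q x) = k * (σ * (empirical y x - Q x)) := by
    intro k hk σ y
    have hk0 : (k : ℝ) ≠ 0 := by exact_mod_cast hk.ne'
    rw [← Finset.mul_sum, Finset.sum_sub_distrib, empirical]
    simp only [Finset.sum_const, Finset.card_univ, Fintype.card_fin, nsmul_eq_mul]
    field_simp
  have hexp : ∀ k : ℕ, (k : ℝ) * ((slowRadius k / 2) ^ 2 * 1 ^ 2 - slowRadius k / 2 * slowRadius k)
      = -(√k / 4) := by
    intro k
    rw [← mul_slowRadius_sq k]
    ring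
  have hs : ∀ {k : ℕ}, 0 < k → slowRadius k / 2 * 1 ≤ 1 := fun hk => by
    linarith [slowRadius_le_one hk]
  constructor
  · have hdev : ∀ σ : ℝ, |σ| = 1 → prodProb Q Q {z : (Fin a → X) × (Fin b → X) |
        slowRadius a ≤ σ * (empirical z.1 x - Q x)} ≤ Real.exp (-(√a / 4)) := by
      intro σ hσ
      have h := prodProb_deviation_le (a := a) (b := b) Q Q (hcentre σ) (h₂ := fun _ => 0) (B₂ := 0)
        (by simp) (slowRadius a) 0 (div_nonneg (slowRadius_nonneg a) zero_le_two) (hbound σ hσ) (by simp)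
        (hs ha) (by simp)
      have e : (b : ℝ) * ((slowRadius a / 2) ^ 2 * 0 ^ 2 - slowRadius a / 2 * 0) = 0 := by ring
      rw [hexp, e, add_zero] at h
      refine (prodProb_mono Q Q fun z hz => ?_).trans h
      change slowRadius a ≤ σ * (empirical z.1 x - Q x) at hz
      simp only [Set.mem_ofPred_eq, hemp ha, Finset.sum_const_zero, mul_zero, add_zero]
      exact mul_le_mul_of_nonneg_left hz (Nat.cast_nonneg _)
    refine (prodProb_mono Q Q fun z hz => ?_).trans ((prodProb_union_le Q Q _ _).trans
      ((add_le_add (hdev 1 (by simp)) (hdev (-1) (by simp))).trans_eq (by ring)))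
    rcases lt_abs.1 (show slowRadius a < |empirical z.1 x - Q x| from hz) with h | h
    · exact Or.inl (by simpa using h.le)
    · exact Or.inr (by simpa using h.le)
  · have hdev : ∀ σ : ℝ, |σ| = 1 → prodProb Q Q {z : (Fin a → X) × (Fin b → X) |
        slowRadius b ≤ σ * (empirical z.2 x - Q x)} ≤ Real.exp (-(√b / 4)) := by
      intro σ hσ
      have h := prodProb_deviation_le (a := a) (b := b) Q Q (h₁ := fun _ => 0) (B₁ := 0) (by simp)
        (hcentre σ) 0 (slowRadius b) (div_nonneg (slowRadius_nonneg b) zero_le_two) (by simp) (hbound σ hσ)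
        (by simp) (hs hb)
      have e : (a : ℝ) * ((slowRadius b / 2) ^ 2 * 0 ^ 2 - slowRadius b / 2 * 0) = 0 := by ring
      rw [hexp, e, zero_add] at h
      refine (prodProb_mono Q Q fun z hz => ?_).trans h
      change slowRadius b ≤ σ * (empirical z.2 x - Q x) at hz
      simp only [Set.mem_ofPred_eq, hemp hb, Finset.sum_const_zero, mul_zero, zero_add]
      exact mul_le_mul_of_nonneg_left hz (Nat.cast_nonneg _)
    refine (prodProb_mono Q Q fun z hz => ?_).trans ((prodProb_union_le Q Q _ _).trans
      ((add_le_add (hdev 1 (by simp)) (hdev (-1) (by simp))).trans_eq (by ring)))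
    rcases lt_abs.1 (show slowRadius b < |empirical z.2 x - Q x| from hz) with h | h
    · exact Or.inl (by simpa using h.le)
    · exact Or.inr (by simpa using h.le)

lemma exists_lt_abs_of_lt_dist {u v : X → ℝ} {d : ℝ} (hd : 0 ≤ d) (h : d < dist u v) :
    ∃ x, d < |u x - v x| := by
  by_contra! hc
  exact h.not_ge ((dist_pi_le_iff hd).2 hc)

lemma falseAlarmProb_typeRules_le {n₁ n₂ : ℕ → ℕ} {Qs : Set (ProbDist X)} {Q : ProbDist X}
    (hQ : Q ∈ Qs) {n : ℕ} (h₁ : 0 < n₁ n) (h₂ : 0 < n₂ n) :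
    falseAlarmProb (typeRules n₁ n₂ Qs) Q n ≤
      Fintype.card X * (2 * Real.exp (-(√(n₁ n) / 4)) + 2 * Real.exp (-(√(n₂ n) / 4))) := by
  have hsub : typeRules n₁ n₂ Qs n ⊆ ⋃ x ∈ (Finset.univ : Finset X),
      ({z | slowRadius (n₁ n) < |empirical z.1 x - Q x|} ∪
        {z | slowRadius (n₂ n) < |empirical z.2 x - Q x|}) := by
    intro z hz
    have hz' : ¬ (dist (empirical z.1) Q.1 ≤ slowRadius (n₁ n) ∧
        dist (empirical z.2) Q.1 ≤ slowRadius (n₂ n)) := fun h => hz ⟨Q, hQ, h⟩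
    rw [not_and_or, not_le, not_le] at hz'
    rcases hz' with h | h
    · obtain ⟨x, hx⟩ := exists_lt_abs_of_lt_dist (slowRadius_nonneg _) h
      exact Set.mem_iUnion₂.2 ⟨x, Finset.mem_univ x, Or.inl hx⟩
    · obtain ⟨x, hx⟩ := exists_lt_abs_of_lt_dist (slowRadius_nonneg _) h
      exact Set.mem_iUnion₂.2 ⟨x, Finset.mem_univ x, Or.inr hx⟩
  refine (prodProb_mono Q Q hsub).trans ((prodProb_biUnion_le Q Q _ _).trans ?_)
  rw [← nsmul_eq_mul, ← Finset.card_univ]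
  refine Finset.sum_le_card_nsmul _ _ _ fun x _ => (prodProb_union_le Q Q _ _).trans ?_
  obtain ⟨h3, h4⟩ := prodProb_abs_empirical_sub_le Q x h₁ h₂
  exact add_le_add h3 h4

lemma typeRules_mem_feasible {n₁ n₂ : ℕ → ℕ} (h₁ : Tendsto (fun n => (n₁ n : ℝ)) atTop atTop)
    (h₂ : Tendsto (fun n => (n₂ n : ℝ)) atTop atTop) (Qs : Set (ProbDist X)) :
    typeRules n₁ n₂ Qs ∈ feasible n₁ n₂ Qs := by
  intro Q hQ
  have hexp : ∀ {m : ℕ → ℕ}, Tendsto (fun n => (m n : ℝ)) atTop atTop →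
      Tendsto (fun n => 2 * Real.exp (-(√(m n) / 4))) atTop (𝓝 0) := by
    intro m hm
    have := (Real.tendsto_exp_neg_atTop_nhds_zero.comp
      ((Real.tendsto_sqrt_atTop.comp hm).atTop_div_const (by norm_num : (0 : ℝ) < 4))).const_mul 2
    rwa [mul_zero] at this
  have hlim := ((hexp h₁).add (hexp h₂)).const_mul (Fintype.card X : ℝ)
  rw [add_zero, mul_zero] at hlim
  refine squeeze_zero' (Eventually.of_forall fun n => prodProb_nonneg _ _ _) ?_ hlim
  filter_upwards [h₁.eventually_gt_atTop 0, h₂.eventually_gt_atTop 0] with n hn1 hn2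
  exact falseAlarmProb_typeRules_le hQ (by exact_mod_cast hn1) (by exact_mod_cast hn2)

lemma prodProb_empirical_le {a b : ℕ} (ha : 0 < a) (hb : 0 < b) {P₁ P₂ : ProbDist X} {f₁ f₂ : X → ℝ}
    (h₁ : ∑ x, P₁ x * Real.exp (f₁ x) ≤ 1) (h₂ : ∑ x, P₂ x * Real.exp (f₂ x) ≤ 1) (v₁ v₂ : ℝ) :
    prodProb P₁ P₂ {z : (Fin a → X) × (Fin b → X) |
        v₁ ≤ ∑ x, empirical z.1 x * f₁ x ∧ v₂ ≤ ∑ x, empirical z.2 x * f₂ x} ≤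
      Real.exp (-(a * v₁ + b * v₂)) := by
  have key : ∀ (P : ProbDist X) (f : X → ℝ) (v : ℝ), ∑ x, P x * Real.exp (f x) ≤ 1 →
      ∑ x, P x * Real.exp (f x - v) ≤ Real.exp (-v) := by
    intro P f v h
    simp only [sub_eq_add_neg, Real.exp_add, ← mul_assoc]
    rw [← Finset.sum_mul]
    exact mul_le_of_le_one_left (Real.exp_pos _).le h
  have hn : ∀ (P : ProbDist X) (f : X → ℝ), 0 ≤ ∑ x, P x * Real.exp (f x) :=
    fun P f => Finset.sum_nonneg fun x _ => mul_nonneg (P.nonneg x) (Real.exp_pos _).le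
  refine (prodProb_le_of_sum_nonneg P₁ P₂ (fun x => f₁ x - v₁) (fun x => f₂ x - v₂) ?_).trans ?_
  · rintro z ⟨hz₁, hz₂⟩
    simp only [Finset.sum_sub_distrib, Finset.sum_const, Finset.card_univ, Fintype.card_fin,
      nsmul_eq_mul]
    rw [← sum_empirical_mul ha, ← sum_empirical_mul hb, ← mul_sub, ← mul_sub]
    exact add_nonneg (mul_nonneg (Nat.cast_nonneg _) (sub_nonneg.2 hz₁))
      (mul_nonneg (Nat.cast_nonneg _) (sub_nonneg.2 hz₂))
  · rw [neg_add, Real.exp_add, ← mul_neg, ← mul_neg, Real.exp_nat_mul, Real.exp_nat_mul]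
    exact mul_le_mul (pow_le_pow_left₀ (hn _ _) (key _ _ _ h₁) _)
      (pow_le_pow_left₀ (hn _ _) (key _ _ _ h₂) _) (pow_nonneg (hn _ _) _)
      (pow_nonneg (Real.exp_pos _).le _)

/-- Each `T` in the closure comes with a pair of half-spaces that contains it and that types rarely
enter under `P₁`, `P₂`. Finitely many pairs suffice, and a union bound concludes. -/
lemma le_missExponent_typeRules {r : ℝ} {n₁ n₂ : ℕ → ℕ} (hr : 0 < r) (hsum : ∀ n, n₁ n + n₂ n = n)
    (hratio : Tendsto (fun n => (n₂ n : ℝ) / (n₁ n : ℝ)) atTop (𝓝 r)) {Qs : Set (ProbDist X)}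
    {P₁ P₂ : ProbDist X} {M : ℝ}
    (h : ∀ T ∈ closure Qs, ∃ f₁ f₂ : X → ℝ, ∑ x, P₁ x * Real.exp (f₁ x) ≤ 1 ∧
      ∑ x, P₂ x * Real.exp (f₂ x) ≤ 1 ∧
      (1 + r) * M < ∑ x, T x * f₁ x + r * ∑ x, T x * f₂ x) :
    (M : EReal) ≤ missExponent (typeRules n₁ n₂ Qs) P₁ P₂ := by
  have h' : ∀ T : closure Qs, ∃ (f₁ f₂ : X → ℝ) (v₁ v₂ : ℝ), ∑ x, P₁ x * Real.exp (f₁ x) ≤ 1 ∧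
      ∑ x, P₂ x * Real.exp (f₂ x) ≤ 1 ∧ v₁ < ∑ x, T.1 x * f₁ x ∧ v₂ < ∑ x, T.1 x * f₂ x ∧
      (1 + r) * M < v₁ + r * v₂ := by
    rintro ⟨T, hT⟩
    obtain ⟨f₁, f₂, h₁, h₂, h₃⟩ := h T hT
    set A := ∑ x, T x * f₁ x
    set B := ∑ x, T x * f₂ x
    -- Lowering both thresholds by `e` costs half of the gap and makes the half-spaces open
    -- neighbourhoods of `T`.
    set e := (A + r * B - (1 + r) * M) / (2 * (1 + r)) with he
    have he0 : 0 < e := div_pos (by linarith) (by positivity)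
    refine ⟨f₁, f₂, A - e, B - e, h₁, h₂, by linarith, by linarith, ?_⟩
    have : 2 * ((1 + r) * e) = A + r * B - (1 + r) * M := by rw [he]; field_simp
    linarith
  choose f₁ f₂ v₁ v₂ hf₁ hf₂ hv₁ hv₂ hM using h'
  let U : closure Qs → Set (X → ℝ) := fun T =>
    {t | v₁ T < ∑ x, t x * f₁ T x ∧ v₂ T < ∑ x, t x * f₂ T x}
  have hUo : ∀ T, IsOpen (U T) := fun T =>
    (isOpen_lt continuous_const (continuous_finsetSum _ fun x _ =>
      (continuous_apply x).mul continuous_const)).inter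
    (isOpen_lt continuous_const (continuous_finsetSum _ fun x _ =>
      (continuous_apply x).mul continuous_const))
  have hK : IsCompact (Subtype.val '' closure Qs : Set (X → ℝ)) :=
    (isClosed_closure.isCompact).image continuous_subtype_val
  obtain ⟨s, hs⟩ := hK.elim_finite_subcover U hUo (by
    rintro _ ⟨T, hT, rfl⟩
    exact Set.mem_iUnion.2 ⟨⟨T, hT⟩, hv₁ ⟨T, hT⟩, hv₂ ⟨T, hT⟩⟩)
  -- Below the Lebesgue number, both types fall in the same `U i` as the noise distribution they are
  -- close to.
  obtain ⟨δ, hδ, hball⟩ := lebesgue_number_lemma_of_metric (c := fun i : s => U i) hK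
    (fun i => hUo i) (by
      intro t ht
      obtain ⟨i, hi, hti⟩ := Set.mem_iUnion₂.1 (hs ht)
      exact Set.mem_iUnion.2 ⟨⟨i, hi⟩, hti⟩)
  have hn₁ := tendsto_atTop_of_fraction (by positivity) (tendsto_first_fraction hr hsum hratio)
  have hn₂ := tendsto_atTop_of_fraction (by positivity) (tendsto_second_fraction hr hsum hratio)
  have hgrow : ∀ᶠ n : ℕ in atTop, ∀ T ∈ s,
      Real.log (s.card + 1) ≤ n₁ n * v₁ T + n₂ n * v₂ T - n * M :=
    (Finset.eventually_all s).2 fun T _ =>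
      (tendsto_sub_mul_atTop hr hsum hratio (hM T)).eventually_ge_atTop _
  refine le_liminf_of_le (by isBoundedDefault) ?_
  filter_upwards [hgrow, hn₁.eventually_gt_atTop 0, hn₂.eventually_gt_atTop 0,
    eventually_gt_atTop 0, (tendsto_slowRadius hn₁).eventually (gt_mem_nhds hδ),
    (tendsto_slowRadius hn₂).eventually (gt_mem_nhds hδ)] with n hg h1 h2 h0 hd1 hd2
  have h1' : 0 < n₁ n := by exact_mod_cast h1
  have h2' : 0 < n₂ n := by exact_mod_cast h2
  have hn0 : (0 : ℝ) < n := by exact_mod_cast h0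
  rw [coe_le_coe_mul_iff (inv_pos.2 hn0), inv_inv, le_negLog_iff]
  have hsub : (typeRules n₁ n₂ Qs n)ᶜ ⊆ ⋃ T ∈ s, {z |
      v₁ T ≤ ∑ x, empirical z.1 x * f₁ T x ∧ v₂ T ≤ ∑ x, empirical z.2 x * f₂ T x} := by
    intro z hz
    rw [typeRules, compl_compl] at hz
    obtain ⟨Q, hQ, hz1, hz2⟩ := hz
    obtain ⟨i, hi⟩ := hball Q.1 ⟨Q, subset_closure hQ, rfl⟩
    have hU1 : empirical z.1 ∈ U i := hi (Metric.mem_ball.2 (hz1.trans_lt hd1))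
    have hU2 : empirical z.2 ∈ U i := hi (Metric.mem_ball.2 (hz2.trans_lt hd2))
    exact Set.mem_iUnion₂.2 ⟨i, i.2, hU1.1.le, hU2.2.le⟩
  have hcard : (0 : ℝ) < s.card + 1 := by positivity
  refine (prodProb_mono P₁ P₂ hsub).trans ((prodProb_biUnion_le P₁ P₂ _ _).trans ?_)
  calc ∑ T ∈ s, prodProb P₁ P₂ {z : (Fin (n₁ n) → X) × (Fin (n₂ n) → X) |
          v₁ T ≤ ∑ x, empirical z.1 x * f₁ T x ∧ v₂ T ≤ ∑ x, empirical z.2 x * f₂ T x}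
      ≤ s.card • (Real.exp (-(n * M)) * ((s.card : ℝ) + 1)⁻¹) := by
        refine Finset.sum_le_card_nsmul _ _ _ fun T hT =>
          (prodProb_empirical_le h1' h2' (hf₁ T) (hf₂ T) _ _).trans ?_
        rw [← Real.exp_log hcard, ← Real.exp_neg, ← Real.exp_add, Real.exp_le_exp]
        linarith [hg T hT]
    _ ≤ Real.exp (-(n * M)) := by
        rw [nsmul_eq_mul, mul_left_comm]
        refine mul_le_of_le_one_right (Real.exp_pos _).le ?_
        rw [← div_eq_mul_inv, div_le_one hcard]
        linarith

/-- The functions are smoothed log-likelihood ratios `log (T / P)`, with means close to relative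
entropies. Jensen's inequality bounds `exp` of minus `α` times their weighted mean by the Rényi sum,
up to the smoothing. -/
lemma exists_tilt {r α : ℝ} (hr : 0 < r) (hα : 0 < α) {P₁ P₂ T : ProbDist X} {M : ℝ}
    (h : renyiSum r α P₁ P₂ T < Real.exp (-((1 + r) * α * M))) :
    ∃ f₁ f₂ : X → ℝ, ∑ x, P₁ x * Real.exp (f₁ x) ≤ 1 ∧
      ∑ x, P₂ x * Real.exp (f₂ x) ≤ 1 ∧
      (1 + r) * M < ∑ x, T x * f₁ x + r * ∑ x, T x * f₂ x := by
  obtain ⟨K, hKdef⟩ : ∃ K : ℝ, K = Fintype.card X := ⟨_, rfl⟩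
  have hK : 0 ≤ K := hKdef ▸ Nat.cast_nonneg _
  -- Adding `ε` to all masses keeps the logarithms finite off the supports; `1 + K * ε` is the new
  -- total mass. Continuity of `V` at 0 preserves the strict inequality.
  let V : ℝ → ℝ := fun ε =>
    (∑ x, (P₁ x + ε) ^ α * (P₂ x + ε) ^ (r * α) * T x ^ (1 - (1 + r) * α)) *
      (1 + K * ε) ^ ((1 + r) * α)
  have hrα : 0 < r * α := mul_pos hr hα
  have hr1 : 0 < 1 + r := by positivity
  have hVc : Continuous V := by
    refine (continuous_finsetSum _ fun x _ => ?_).mul ?_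
    · exact (((continuous_const.add continuous_id).rpow_const fun _ => Or.inr hα.le).mul
        ((continuous_const.add continuous_id).rpow_const fun _ => Or.inr hrα.le)).mul
        continuous_const
    · exact (continuous_const.add (continuous_const.mul continuous_id)).rpow_const
        fun _ => Or.inr (mul_pos hr1 hα).le
  have hV0 : V 0 < Real.exp (-((1 + r) * α * M)) := by
    simpa [V, renyiSum] using h
  obtain ⟨ε, hVε, hε⟩ := (((hVc.tendsto 0).eventually (gt_mem_nhds hV0)).filter_mono
    nhdsWithin_le_nhds |>.and self_mem_nhdsWithin : ∀ᶠ ε in 𝓝[>] (0 : ℝ), _).exists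
  have hε : 0 < ε := hε
  have hpos : ∀ (P : ProbDist X) x, 0 < P x + ε := fun P x => add_pos_of_nonneg_of_pos (P.nonneg x) hε
  have hKε : 0 < 1 + K * ε := by positivity
  let f : ProbDist X → X → ℝ := fun P x =>
    Real.log (T x + ε) - Real.log (P x + ε) - Real.log (1 + K * ε)
  have hf : ∀ P : ProbDist X, ∑ x, P x * Real.exp (f P x) ≤ 1 := by
    intro P
    calc ∑ x, P x * Real.exp (f P x) ≤ ∑ x, (T x + ε) / (1 + K * ε) := by
          refine Finset.sum_le_sum fun x _ => ?_
          rw [Real.exp_sub, Real.exp_sub, Real.exp_log (hpos T x), Real.exp_log (hpos P x),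
            Real.exp_log hKε, ← mul_div_assoc]
          refine div_le_div_of_nonneg_right ?_ hKε.le
          rw [mul_div_left_comm]
          refine mul_le_of_le_one_right (hpos T x).le ((div_le_one (hpos P x)).2 (by linarith))
      _ = 1 := by
          rw [← Finset.sum_div, Finset.sum_add_distrib, T.sum_eq]
          simp only [Finset.sum_const, Finset.card_univ, nsmul_eq_mul, ← hKdef]
          exact div_self hKε.ne'
  refine ⟨f P₁, f P₂, hf P₁, hf P₂, ?_⟩
  let g : X → ℝ := fun x => α * (Real.log (P₁ x + ε) - Real.log (T x + ε)) +
    r * α * (Real.log (P₂ x + ε) - Real.log (T x + ε))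
  have hJ : Real.exp (∑ x, T x * g x) ≤ ∑ x, T x * Real.exp (g x) :=
    convexOn_exp.map_sum_le (fun x _ => T.nonneg x) T.sum_eq (fun _ _ => Set.mem_univ _)
  have hterm : ∀ x, T x * Real.exp (g x) ≤
      (P₁ x + ε) ^ α * (P₂ x + ε) ^ (r * α) * T x ^ (1 - (1 + r) * α) := by
    intro x
    rcases (T.nonneg x).eq_or_lt with h0 | h0
    · rw [← h0, zero_mul]
      exact mul_nonneg (mul_nonneg (Real.rpow_nonneg (hpos _ _).le _)
        (Real.rpow_nonneg (hpos _ _).le _)) (Real.rpow_nonneg le_rfl _)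
    · rw [Real.rpow_def_of_pos (hpos _ _), Real.rpow_def_of_pos (hpos _ _), Real.rpow_def_of_pos h0,
        ← Real.exp_add, ← Real.exp_add]
      nth_rewrite 1 [← Real.exp_log h0]
      rw [← Real.exp_add, Real.exp_le_exp]
      have hlog : Real.log (T x) ≤ Real.log (T x + ε) := Real.log_le_log h0 (by linarith)
      have := mul_le_mul_of_nonneg_left hlog (mul_pos hr1 hα).le
      simp only [g]
      linarith
  have hmain : ∑ x, T x * g x + (1 + r) * α * Real.log (1 + K * ε) < -((1 + r) * α * M) := by
    rw [← Real.exp_lt_exp, Real.exp_add]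
    refine lt_of_le_of_lt ?_ hVε
    have : Real.exp ((1 + r) * α * Real.log (1 + K * ε)) = (1 + K * ε) ^ ((1 + r) * α) := by
      rw [Real.rpow_def_of_pos hKε, mul_comm]
    rw [this]
    exact mul_le_mul_of_nonneg_right (hJ.trans (Finset.sum_le_sum fun x _ => hterm x))
      (Real.rpow_nonneg hKε.le _)
  have hrel : ∑ x, T x * f P₁ x + r * ∑ x, T x * f P₂ x =
      -(α⁻¹ * ∑ x, T x * g x) - (1 + r) * Real.log (1 + K * ε) := by
    have e1 : (1 + r) * Real.log (1 + K * ε) = ∑ x, T x * ((1 + r) * Real.log (1 + K * ε)) := by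
      rw [← Finset.sum_mul, T.sum_eq, one_mul]
    rw [e1, Finset.mul_sum, Finset.mul_sum, ← Finset.sum_neg_distrib, ← Finset.sum_add_distrib,
      ← Finset.sum_sub_distrib]
    refine Finset.sum_congr rfl fun x _ => ?_
    simp only [f, g]
    field_simp
    ring
  rw [hrel]
  have h5 : α * ((1 + r) * M) < α * (-(α⁻¹ * ∑ x, T x * g x) - (1 + r) * Real.log (1 + K * ε)) := by
    rw [mul_sub, mul_neg, mul_inv_cancel_left₀ hα.ne']
    linarith
  exact lt_of_mul_lt_mul_left h5 hα.le

lemma renyiExponent_le_optExponent {r : ℝ} {n₁ n₂ : ℕ → ℕ} (hr : 0 < r)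
    (hsum : ∀ n, n₁ n + n₂ n = n)
    (hratio : Tendsto (fun n => (n₂ n : ℝ) / (n₁ n : ℝ)) atTop (𝓝 r))
    (Ps₁ Ps₂ Qs : Set (ProbDist X)) {α : ℝ} (hα : 0 < α) (hα1 : α ≤ (1 + r)⁻¹) :
    renyiExponent r Ps₁ Ps₂ Qs α ≤ optExponent n₁ n₂ Ps₁ Ps₂ Qs := by
  refine EReal.ge_of_forall_gt_iff_ge.1 fun M hM => ?_
  obtain ⟨M', hMM', hM'⟩ := EReal.lt_iff_exists_real_btwn.1 hM
  have hMM' : M < M' := by exact_mod_cast hMM'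
  have hb := (coe_le_renyiExponent_iff hr hα _ _ _ _).1 hM'.le
  have h1 := mul_le_one_of_le_inv hr hα1
  have hr1 : 0 < 1 + r := by positivity
  -- Halving the order gives the strict inequality required by `renyiSum_le_of_mem_closure`;
  -- monotonicity keeps the bound `M'`.
  have hhalf : (1 + r) * (α / 2) < 1 := by nlinarith [mul_pos hr1 hα]
  have hfeas : typeRules n₁ n₂ Qs ∈ feasible n₁ n₂ Qs := typeRules_mem_feasible
    (tendsto_atTop_of_fraction (by positivity) (tendsto_first_fraction hr hsum hratio))
    (tendsto_atTop_of_fraction (by positivity) (tendsto_second_fraction hr hsum hratio)) Qs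
  refine le_iSup₂_of_le (typeRules n₁ n₂ Qs) hfeas ?_
  refine le_iInf₂ fun P₁ h₁ => le_iInf₂ fun P₂ h₂ =>
    le_missExponent_typeRules hr hsum hratio fun T hT => exists_tilt hr (half_pos hα) ?_
  refine (renyiSum_le_of_mem_closure hr (half_pos hα) hhalf (fun Q hQ =>
    renyiSum_le_exp_of_le hr (half_pos hα) (half_le_self hα.le) h1
      (hb P₁ h₁ P₂ h₂ Q hQ)) hT).trans_lt ?_
  rw [Real.exp_lt_exp, neg_lt_neg_iff]
  exact mul_lt_mul_of_pos_left hMM' (mul_pos hr1 (half_pos hα))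

end Achievability

/-! ### Orders tending to 0. -/

section Limit

variable {X : Type*} [Fintype X]

/-- If `T` charged a point where `P₁` or `P₂` vanishes, that term would be 0 at every order. The
rest is bounded by a sum tending to `1 - T x₀ < 1`, while the lower bound tends to 1. -/
lemma mem_commonSupport_of_le_renyiSum {r b : ℝ} (hr : 0 < r) {P₁ P₂ T : ProbDist X} {α : ℕ → ℝ}
    (hα : ∀ k, 0 < α k) (hα0 : Tendsto α atTop (𝓝 0))
    (h : ∀ k, Real.exp (-((1 + r) * α k * b)) ≤ renyiSum r (α k) P₁ P₂ T) :
    T ∈ commonSupport P₁ P₂ := by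
  classical
  intro x₀ hx₀
  by_contra hcon
  have hzero : ∀ k, P₁ x₀ ^ α k * P₂ x₀ ^ (r * α k) = 0 := by
    intro k
    rw [not_and_or, not_not, not_not] at hcon
    rcases hcon with h0 | h0
    · rw [h0, Real.zero_rpow (hα k).ne', zero_mul]
    · rw [h0, Real.zero_rpow (mul_pos hr (hα k)).ne', mul_zero]
  have hle : ∀ k, Real.exp (-((1 + r) * α k * b)) ≤
      ∑ x ∈ Finset.univ.erase x₀, T x ^ (1 - (1 + r) * α k) := by
    intro k
    refine (h k).trans ?_
    rw [renyiSum, ← Finset.add_sum_erase _ _ (Finset.mem_univ x₀), hzero k, zero_mul, zero_add]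
    refine Finset.sum_le_sum fun x _ => mul_le_of_le_one_left (Real.rpow_nonneg (T.nonneg x) _) ?_
    exact mul_le_one₀ (Real.rpow_le_one (P₁.nonneg x) (P₁.le_one x) (hα k).le)
      (Real.rpow_nonneg (P₂.nonneg x) _)
      (Real.rpow_le_one (P₂.nonneg x) (P₂.le_one x) (mul_pos hr (hα k)).le)
  have hlim1 : Tendsto (fun k => Real.exp (-((1 + r) * α k * b))) atTop (𝓝 1) := by
    have : Tendsto (fun k => -((1 + r) * α k * b)) atTop (𝓝 0) := by
      simpa using ((hα0.const_mul (1 + r)).mul_const b).neg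
    simpa [Function.comp_def] using (Real.continuous_exp.tendsto 0).comp this
  have hlim2 : Tendsto (fun k => ∑ x ∈ Finset.univ.erase x₀, T x ^ (1 - (1 + r) * α k)) atTop
      (𝓝 (∑ x ∈ Finset.univ.erase x₀, T x)) := by
    refine tendsto_finsetSum _ fun x _ => ?_
    have he : Tendsto (fun k => 1 - (1 + r) * α k) atTop (𝓝 1) := by
      simpa using (hα0.const_mul (1 + r)).const_sub 1
    simpa using tendsto_const_nhds.rpow he (Or.inr one_pos)
  have h1 := le_of_tendsto_of_tendsto' hlim1 hlim2 hle
  have h2 := Finset.add_sum_erase Finset.univ (fun x => T x) (Finset.mem_univ x₀)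
  rw [T.sum_eq] at h2
  have h3 : 0 < T x₀ := lt_of_le_of_ne (T.nonneg x₀) hx₀.symm
  linarith

lemma renyiSum_eq_sum_exp {r α : ℝ} (hα : (1 + r) * α < 1) {P₁ P₂ T : ProbDist X}
    (hT : T ∈ commonSupport P₁ P₂) : renyiSum r α P₁ P₂ T =
      ∑ x, T x * Real.exp (α * -(logRatio T P₁ x + r * logRatio T P₂ x)) := by
  refine Finset.sum_congr rfl fun x _ => ?_
  rcases (T.nonneg x).eq_or_lt with h0 | h0
  · rw [← h0, Real.zero_rpow (sub_pos.2 hα).ne', mul_zero, zero_mul]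
  · obtain ⟨h1, h2⟩ := hT x h0.ne'
    have h1 : 0 < P₁ x := lt_of_le_of_ne (P₁.nonneg x) h1.symm
    have h2 : 0 < P₂ x := lt_of_le_of_ne (P₂.nonneg x) h2.symm
    rw [Real.rpow_def_of_pos h1, Real.rpow_def_of_pos h2, Real.rpow_def_of_pos h0,
      ← Real.exp_add, ← Real.exp_add]
    nth_rewrite 2 [← Real.exp_log h0]
    rw [← Real.exp_add, logRatio, logRatio]
    congr 1
    ring

/-- The Rényi sum minus `exp (-((1 + r) * α * b))` vanishes at `α = 0` and is nonnegative along the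
sequence, so its derivative at 0 is nonnegative; that is the claim. -/
lemma sum_logRatio_le_of_le_renyiSum {r b : ℝ} {P₁ P₂ T : ProbDist X}
    {α : ℕ → ℝ} (hα : ∀ k, 0 < α k) (hα0 : Tendsto α atTop (𝓝 0)) (hα1 : ∀ k, (1 + r) * α k < 1)
    (h : ∀ k, Real.exp (-((1 + r) * α k * b)) ≤ renyiSum r (α k) P₁ P₂ T)
    (hT : T ∈ commonSupport P₁ P₂) :
    ∑ x, T x * logRatio T P₁ x + r * ∑ x, T x * logRatio T P₂ x ≤ (1 + r) * b := by
  let g : X → ℝ := fun x => -(logRatio T P₁ x + r * logRatio T P₂ x)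
  let F : ℝ → ℝ := fun t => ∑ x, T x * Real.exp (t * g x) - Real.exp (t * -((1 + r) * b))
  have hexp : ∀ c : ℝ, HasDerivAt (fun t : ℝ => Real.exp (t * c)) c 0 := by
    intro c
    simpa using ((hasDerivAt_id (0 : ℝ)).mul_const c).exp
  have hF : HasDerivAt F (∑ x, T x * g x - -((1 + r) * b)) 0 :=
    (HasDerivAt.fun_sum fun x _ => (hexp (g x)).const_mul (T x)).sub (hexp _)
  have hF0 : F 0 = 0 := by simp [F, T.sum_eq]
  have hα' : Tendsto α atTop (𝓝[≠] 0) :=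
    tendsto_nhdsWithin_iff.2 ⟨hα0, Eventually.of_forall fun k => (hα k).ne'⟩
  have hslope := (hasDerivAt_iff_tendsto_slope.1 hF).comp hα'
  have hnn : 0 ≤ ∑ x, T x * g x - -((1 + r) * b) := by
    refine ge_of_tendsto' hslope fun k => ?_
    rw [Function.comp_apply, slope_def_field, hF0, sub_zero, sub_zero]
    refine div_nonneg (sub_nonneg.2 ?_) (hα k).le
    rw [← renyiSum_eq_sum_exp (hα1 k) hT]
    refine le_trans (le_of_eq ?_) (h k)
    congr 1
    ring
  have hsum : ∑ x, T x * g x =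
      -(∑ x, T x * logRatio T P₁ x + r * ∑ x, T x * logRatio T P₂ x) := by
    rw [Finset.mul_sum, ← Finset.sum_add_distrib, ← Finset.sum_neg_distrib]
    refine Finset.sum_congr rfl fun x _ => ?_
    simp only [g]
    ring
  linarith

/-- A finite limiting relative entropy at a point of the closures is approximated by members of the
families whose supports are compatible. -/
lemma exists_approximation {r c : ℝ} {Ps₁ Ps₂ Qs : Set (ProbDist X)}
    (hclosure : ∀ P₁ ∈ Ps₁, ∀ P₂ ∈ Ps₂, closure Qs ∩ commonSupport P₁ P₂ ⊆
      closure (Qs ∩ commonSupport P₁ P₂)) {P₁ P₂ T : ProbDist X} (h₁ : P₁ ∈ closure Ps₁)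
    (h₂ : P₂ ∈ closure Ps₂) (hT : T ∈ closure Qs) (hTs : T ∈ commonSupport P₁ P₂)
    (hc : ∑ x, T x * logRatio T P₁ x + r * ∑ x, T x * logRatio T P₂ x < c) :
    ∃ P₁' ∈ Ps₁, ∃ P₂' ∈ Ps₂, ∃ Q ∈ Qs, Q ∈ commonSupport P₁' P₂' ∧
      ∑ x, Q x * logRatio Q P₁' x + r * ∑ x, Q x * logRatio Q P₂' x < c := by
  have hmem : (P₁, P₂) ∈ closure (Ps₁ ×ˢ Ps₂) := by
    rw [closure_prod_eq]
    exact ⟨h₁, h₂⟩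
  have hcont : ∀ (π : ProbDist X × ProbDist X → ProbDist X), Continuous π →
      (∀ x, T x ≠ 0 → π (P₁, P₂) x ≠ 0) →
      ContinuousAt (fun p => ∑ x, T x * logRatio T (π p) x) (P₁, P₂) := by
    intro π hπ hne
    refine tendsto_finsetSum _ fun x _ => ?_
    by_cases hx : T x = 0
    · simp [hx]
    · exact (tendsto_const_nhds.sub ((((ProbDist.continuous_apply x).comp hπ).tendsto _).log
        (hne x hx))).const_mul _
  have hcont' : ContinuousAt (fun p : ProbDist X × ProbDist X =>
      ∑ x, T x * logRatio T p.1 x + r * ∑ x, T x * logRatio T p.2 x) (P₁, P₂) :=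
    (hcont _ continuous_fst fun x hx => (hTs x hx).1).add
      ((hcont _ continuous_snd fun x hx => (hTs x hx).2).const_mul r)
  have hsupp : ∀ᶠ p : ProbDist X × ProbDist X in 𝓝 (P₁, P₂), T ∈ commonSupport p.1 p.2 := by
    refine eventually_all.2 fun x => ?_
    by_cases hx : T x = 0
    · exact Eventually.of_forall fun p hne => absurd hx hne
    · have e1 := (((ProbDist.continuous_apply x).comp continuous_fst).tendsto
        (P₁, P₂)).eventually_ne (hTs x hx).1
      have e2 := (((ProbDist.continuous_apply x).comp continuous_snd).tendsto
        (P₁, P₂)).eventually_ne (hTs x hx).2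
      filter_upwards [e1, e2] with p hp1 hp2 _ using ⟨hp1, hp2⟩
  -- The pair moves first, with `T` fixed: on a finite alphabet, support inclusion is an open
  -- condition on the pair.
  obtain ⟨⟨P₁', P₂'⟩, ⟨hP₁', hP₂'⟩, hlt, hs⟩ := ((mem_closure_iff_frequently.1 hmem).and_eventually
    ((hcont'.eventually (gt_mem_nhds hc)).and hsupp)).exists
  -- Now `T` moves, with the pair fixed; continuity of `t * log t` at 0 covers vanishing masses.
  have hmem' := hclosure P₁' hP₁' P₂' hP₂' ⟨hT, hs⟩
  have hQc : ∀ P : ProbDist X, Continuous fun Q : ProbDist X => ∑ x, Q x * logRatio Q P x := by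
    intro P
    refine continuous_finsetSum _ fun x _ => ?_
    simp only [logRatio, mul_sub]
    exact (Real.continuous_mul_log.comp (ProbDist.continuous_apply x)).sub
      ((ProbDist.continuous_apply x).mul continuous_const)
  obtain ⟨Q, ⟨hQ, hQs⟩, hQlt⟩ := ((mem_closure_iff_frequently.1 hmem').and_eventually
    ((((hQc P₁').add ((hQc P₂').const_mul r)).tendsto T).eventually (gt_mem_nhds hlt))).exists
  exact ⟨P₁', hP₁', P₂', hP₂', Q, hQ, hQs, hQlt⟩

/-- Cantor's intersection theorem: a triple that satisfies the bound at a smaller order satisfies it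
at the larger ones by `renyiSum_le_rpow`, so the compact sets `C k` decrease. -/
lemma exists_limit_of_renyiExponent_lt {r b : ℝ} (hr : 0 < r) {Ps₁ Ps₂ Qs : Set (ProbDist X)}
    {α : ℕ → ℝ} (hα : ∀ k, 0 < α k) (hα1 : ∀ k, (1 + r) * α k < 1) (hanti : Antitone α)
    (hb : ∀ k, renyiExponent r Ps₁ Ps₂ Qs (α k) < b) :
    ∃ P₁ ∈ closure Ps₁, ∃ P₂ ∈ closure Ps₂, ∃ T ∈ closure Qs,
      ∀ k, Real.exp (-((1 + r) * α k * b)) ≤ renyiSum r (α k) P₁ P₂ T := by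
  let C : ℕ → Set (ProbDist X × ProbDist X × ProbDist X) := fun k =>
    (closure Ps₁ ×ˢ closure Ps₂ ×ˢ closure Qs) ∩
      {p | Real.exp (-((1 + r) * α k * b)) ≤ renyiSum r (α k) p.1 p.2.1 p.2.2}
  have hclosed : ∀ k, IsClosed (C k) := fun k =>
    (isClosed_closure.prod (isClosed_closure.prod isClosed_closure)).inter
      (isClosed_le continuous_const (continuous_renyiSum hr (hα k) (hα1 k)))
  obtain ⟨⟨P₁, P₂, T⟩, hp⟩ := IsCompact.nonempty_iInter_of_sequence_nonempty_isCompact_isClosed C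
    (by
      rintro k ⟨P₁, P₂, T⟩ ⟨hmem, hle⟩
      refine ⟨hmem, ?_⟩
      change Real.exp (-((1 + r) * α (k + 1) * b)) ≤ renyiSum r (α (k + 1)) P₁ P₂ T at hle
      change Real.exp (-((1 + r) * α k * b)) ≤ renyiSum r (α k) P₁ P₂ T
      by_contra! hlt
      have h1 := hle.trans (renyiSum_le_rpow hr (hα (k + 1)) (hanti k.le_succ) (hα1 k).le P₁ P₂ T)
      have h2 := Real.rpow_lt_rpow (renyiSum_nonneg _ _ _ _ _) hlt (div_pos (hα (k + 1)) (hα k))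
      have h3 : Real.exp (-((1 + r) * α k * b)) ^ (α (k + 1) / α k) =
          Real.exp (-((1 + r) * α (k + 1) * b)) := by
        have := (hα k).ne'
        rw [← Real.exp_mul]
        congr 1
        field_simp
      exact absurd (h1.trans_lt (h2.trans_eq h3)) (lt_irrefl _))
    (by
      intro k
      have hnot := (coe_le_renyiExponent_iff hr (hα k) Ps₁ Ps₂ Qs b).not.1 (hb k).not_ge
      push Not at hnot
      obtain ⟨P₁, h₁, P₂, h₂, Q, hQ, hlt⟩ := hnot
      exact ⟨(P₁, P₂, Q), ⟨subset_closure h₁, subset_closure h₂, subset_closure hQ⟩, hlt.le⟩)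
    (hclosed 0).isCompact hclosed
  have hp := Set.mem_iInter.1 hp
  exact ⟨P₁, (hp 0).1.1, P₂, (hp 0).1.2.1, T, (hp 0).1.2.2, fun k => (hp k).2⟩

lemma exists_lt_renyiExponent {r : ℝ} {n₁ n₂ : ℕ → ℕ} (hr : 0 < r) (hsum : ∀ n, n₁ n + n₂ n = n)
    (hratio : Tendsto (fun n => (n₂ n : ℝ) / (n₁ n : ℝ)) atTop (𝓝 r))
    {Ps₁ Ps₂ Qs : Set (ProbDist X)}
    (hclosure : ∀ P₁ ∈ Ps₁, ∀ P₂ ∈ Ps₂, closure Qs ∩ commonSupport P₁ P₂ ⊆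
      closure (Qs ∩ commonSupport P₁ P₂)) {a : EReal} (ha : a < optExponent n₁ n₂ Ps₁ Ps₂ Qs) :
    ∃ α ∈ Set.Ioc 0 (1 + r)⁻¹, a < renyiExponent r Ps₁ Ps₂ Qs α := by
  by_contra! hcon
  obtain ⟨b, hab, hb⟩ := EReal.lt_iff_exists_real_btwn.1 ha
  obtain ⟨c, hbc, hc⟩ := EReal.lt_iff_exists_real_btwn.1 hb
  have hbc : b < c := by exact_mod_cast hbc
  have hr1 : 0 < 1 + r := by positivity
  -- The denominator is `k + 2`, so `(1 + r) * α k < 1` already at `k = 0`.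
  let α : ℕ → ℝ := fun k => (1 + r)⁻¹ * (1 / ((k + 1 : ℕ) + 1 : ℝ))
  have hfrac : ∀ k : ℕ, (1 : ℝ) / ((k + 1 : ℕ) + 1 : ℝ) < 1 := fun k => by
    rw [div_lt_one (by positivity)]
    push_cast
    have : (0 : ℝ) ≤ k := Nat.cast_nonneg k
    linarith
  have hα : ∀ k, 0 < α k := fun k => by positivity
  have hα1 : ∀ k, (1 + r) * α k < 1 := fun k => by
    simpa only [α, mul_inv_cancel_left₀ hr1.ne'] using hfrac k
  have hαle : ∀ k, α k ≤ (1 + r)⁻¹ := fun k =>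
    mul_le_of_le_one_right (inv_pos.2 hr1).le (hfrac k).le
  have hanti : Antitone α := fun k l hkl => by
    refine mul_le_mul_of_nonneg_left (Nat.one_div_le_one_div ?_) (inv_pos.2 hr1).le
    omega
  have hα0 : Tendsto α atTop (𝓝 0) := by
    have h := (tendsto_one_div_add_atTop_nhds_zero_nat (𝕜 := ℝ)).comp (tendsto_add_atTop_nat 1)
    simpa [α] using h.const_mul (1 + r)⁻¹
  obtain ⟨P₁, h₁, P₂, h₂, T, hT, hle⟩ := exists_limit_of_renyiExponent_lt hr hα hα1 hanti
    fun k => (hcon (α k) ⟨hα k, hαle k⟩).trans_lt hab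
  have hTs := mem_commonSupport_of_le_renyiSum hr hα hα0 hle
  have hG := sum_logRatio_le_of_le_renyiSum hα hα0 hα1 hle hTs
  obtain ⟨P₁', h₁', P₂', h₂', Q, hQ, hQs, hlt⟩ := exists_approximation hclosure h₁ h₂ hT hTs
    (hG.trans_lt (mul_lt_mul_of_pos_left hbc hr1))
  refine absurd (iSup₂_le fun Ω hΩ => ?_ : optExponent n₁ n₂ Ps₁ Ps₂ Qs ≤ c) hc.not_ge
  exact iInf₂_le_of_le P₁' h₁' (iInf₂_le_of_le P₂' h₂'
    (missExponent_le hr hsum hratio hQs (hΩ Q hQ) hlt))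

end Limit

end TwoSensor

theorem theorem3 {X : Type*} [Fintype X] (r : ℝ) (hr : 0 < r)
    (n₁ n₂ : ℕ → ℕ) (hsum : ∀ n, n₁ n + n₂ n = n)
    (hratio : Tendsto (fun n => (n₂ n : ℝ) / (n₁ n : ℝ)) atTop (𝓝 r))
    (Ps₁ Ps₂ Qs : Set (TwoSensor.ProbDist X)) :
    (∀ α : ℝ, 0 < α → α ≤ (1 + r)⁻¹ →
      TwoSensor.renyiExponent r Ps₁ Ps₂ Qs α ≤ TwoSensor.optExponent n₁ n₂ Ps₁ Ps₂ Qs) ∧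
    AntitoneOn (TwoSensor.renyiExponent r Ps₁ Ps₂ Qs) (Set.Ioc 0 (1 + r)⁻¹) ∧
    ((∀ P₁ ∈ Ps₁, ∀ P₂ ∈ Ps₂,
        closure Qs ∩ TwoSensor.commonSupport P₁ P₂ ⊆
          closure (Qs ∩ TwoSensor.commonSupport P₁ P₂)) →
      TwoSensor.optExponent n₁ n₂ Ps₁ Ps₂ Qs < ⊤ →
      Tendsto (TwoSensor.renyiExponent r Ps₁ Ps₂ Qs) (𝓝[>] 0)
        (𝓝 (TwoSensor.optExponent n₁ n₂ Ps₁ Ps₂ Qs))) := by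
  refine ⟨fun α hα hα1 =>
      TwoSensor.renyiExponent_le_optExponent hr hsum hratio Ps₁ Ps₂ Qs hα hα1,
    TwoSensor.renyiExponent_antitoneOn hr Ps₁ Ps₂ Qs, fun hclosure _ => ?_⟩
  refine tendsto_order.2 ⟨fun a ha => ?_, fun a ha => ?_⟩
  · obtain ⟨β, hβ, hlt⟩ := TwoSensor.exists_lt_renyiExponent hr hsum hratio hclosure ha
    filter_upwards [Ioc_mem_nhdsGT hβ.1] with α hα
    exact hlt.trans_le (TwoSensor.renyiExponent_antitoneOn hr Ps₁ Ps₂ Qs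
      ⟨hα.1, hα.2.trans hβ.2⟩ hβ hα.2)
  · filter_upwards [Ioc_mem_nhdsGT (inv_pos.2 (by positivity : 0 < 1 + r))] with α hα
    exact (TwoSensor.renyiExponent_le_optExponent hr hsum hratio Ps₁ Ps₂ Qs hα.1 hα.2).trans_lt ha
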